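/- Let $\mathcal H$ be a Hilbert space of finite dimension $k$, and let $\rho,\sigma$ be density matrices on $\mathcal H$ with $\sigma$ invertible. A PVM is a finite family $E=\{E_i\}$ of orthogonal projections with $\sum_i E_i=I$ (some $E_i$ may be $0$); $w(E)=\max_i \operatorname{rank}E_i$; $E$ commutes with $A$ if $AE_i=E_iA$ for all $i$; $E\le F$ (that is, $F$ refines $E$) means that each $E_i$ is a sum of some of the $F_j$. For a PVM $M$ and a state $\tau$ write $\mathrm P^M_\tau(i)=\operatorname{Tr}M_i\tau$ and $\mathrm E^M_\tau$ for the corresponding expectation. For a sequence $\vec M=\{M^n\}$ of PVMs, $M^n$ acting on $\mathcal H^{\otimes n}$ with outcome set $\Omega_n$, let $$B^{\vec M}(\rho\|\sigma)=\sup\Bigl\{\lambda\in\mathbb R \Bigm| \exists\, T^n:\Omega_n\to[0,1],\ \lim_{n\to\infty}\mathrm E^{M^n}_{\rho^{\otimes n}}(1-T^n)=0,\ \limsup_{n\to\infty}\tfrac1n\log\mathrm E^{M^n}_{\sigma^{\otimes n}}(T^n)\le-\lambda\Bigr\}$$ (with $\log 0=-\infty$), and let $D(\rho\|\sigma)=\operatorname{Tr}\rho(\log\rho-\log\sigma)$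 (with $0\log 0=0$). Let $E^n$ be PVMs on $\mathcal H^{\otimes n}$ that commute with $\rho^{\otimes n}$ and with $\sigma^{\otimes n}$ and satisfy $w(E^n)\le(n+1)^m$ for all $n$, for some fixed $m\in\mathbb N$ (for example $m=k-1$). Then: 1. For every sequence $\vec M=\{M^n\}$ of PVMs with $M^n\ge E^n$ and $w(M^n)=1$ for all $n$, one has $B^{\vec M}(\rho\|\sigma)=D(\rho\|\sigma)$ if and only if $-\frac1n\log\mathrm P^{M^n}_{\sigma^{\otimes n}}$ converges to $-\operatorname{Tr}\rho\log\sigma$ in probability under $\mathrm P^{M^n}_{\rho^{\otimes n}}$, i.e. for every $\varepsilon>0$ $$\lim_{n\to\infty}\mathrm P^{M^n}_{\rho^{\otimes n}}\Bigl\{i : \bigl|-\tfrac1n\log\mathrm P^{M^n}_{\sigma^{\otimes n}}(i)+\operatorname{Tr}\rho\log\sigma\bigr|>\varepsilon\Bigr\}=0.$$ 2. Consequently, if the $M^n$ as in 1 moreover commute with $\sigma^{\otimes n}$, then $B^{\vec M}(\rho\|\sigma)=D(\rho\|\sigma)$; and the sequence of product PVMs $E^n\times E(\sigma^{\otimes n})=\{E^n_iF^n_j\}_{i,j}$,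 where $E(\sigma^{\otimes n})=\{F^n_j\}$ is the family of eigenprojections of $\sigma^{\otimes n}$, is optimal in the same sense: $B^{\{E^n\times E(\sigma^{\otimes n})\}}(\rho\|\sigma)=D(\rho\|\sigma)$. -/

import Mathlib

open Filter Topology Matrix
open scoped ComplexOrder

noncomputable section

/-- A POVM with finitely many outcomes `Ω` on the Hilbert space `ℂ^d` (with `d` a finite index
set): positive semidefinite operators summing up to the identity. -/
structure POVM (Ω d : Type*) [Fintype Ω] [Fintype d] [DecidableEq d] where
  elem : Ω → Matrix d d ℂ
  posSemidef : ∀ i, (elem i).PosSemidef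
  sum_eq_one : ∑ i, elem i = 1

/-- A PVM: a POVM all of whose elements are (orthogonal) projections. -/
structure PVM (Ω d : Type*) [Fintype Ω] [Fintype d] [DecidableEq d] extends POVM Ω d where
  isStarProjection : ∀ i, IsStarProjection (elem i)

/-- Density matrices: positive semidefinite operators of trace one. -/
def IsDensity {d : Type*} [Fintype d] (ρ : Matrix d d ℂ) : Prop :=
  ρ.PosSemidef ∧ ρ.trace = 1

/-- The tensor power `A^{⊗ n}`, acting on `(ℂ^ι)^{⊗ n} = ℂ^(ι^n)`; the vector
`e_{x 0} ⊗ ⋯ ⊗ e_{x (n-1)}` is the basis vector with index `x : Fin n → ι`. -/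
def tensorPow {ι : Type*} (A : Matrix ι ι ℂ) (n : ℕ) : Matrix (Fin n → ι) (Fin n → ι) ℂ :=
  Matrix.of fun x y => ∏ j, A (x j) (y j)

theorem tensorPow_isHermitian {ι : Type*} {A : Matrix ι ι ℂ} (hA : A.IsHermitian) (n : ℕ) :
    (tensorPow A n).IsHermitian := by
  ext x y
  simp only [tensorPow, Matrix.conjTranspose_apply, Matrix.of_apply, star_prod]
  exact Finset.prod_congr rfl fun j _ => hA.apply (x j) (y j)

theorem IsDensity.tensorPow_isHermitian {ι : Type*} [Fintype ι] {A : Matrix ι ι ℂ}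
    (hA : IsDensity A) (n : ℕ) : (tensorPow A n).IsHermitian :=
  _root_.tensorPow_isHermitian hA.1.isHermitian n

/-- The probability `P^M_ρ(i) = Tr M_i ρ` of the outcome `i`. -/
def POVM.prob {Ω d : Type*} [Fintype Ω] [Fintype d] [DecidableEq d]
    (M : POVM Ω d) (ρ : Matrix d d ℂ) (i : Ω) : ℝ :=
  (M.elem i * ρ).trace.re

/-- The expectation `E^M_ρ(f)` of a function `f` of the outcome. -/
def POVM.expect {Ω d : Type*} [Fintype Ω] [Fintype d] [DecidableEq d]
    (M : POVM Ω d) (ρ : Matrix d d ℂ) (f : Ω → ℝ) : ℝ :=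
  ∑ i, f i * M.prob ρ i

open Classical in
/-- The probability `P^M_ρ(S)` of an event `S`. -/
def POVM.probOf {Ω d : Type*} [Fintype Ω] [Fintype d] [DecidableEq d]
    (M : POVM Ω d) (ρ : Matrix d d ℂ) (S : Set Ω) : ℝ :=
  ∑ i with i ∈ S, M.prob ρ i

/-- The optimal second error exponent `B^M(ρ‖σ)` of a sequence `M = (M^n)` of POVMs: the supremum
of the `R` for which some sequence of classical tests `T^n : Ω_n → [0,1]` satisfies
`E^{M^n}_{ρ^{⊗ n}}(1 - T^n) → 0` and
`limsup (1/n) log E^{M^n}_{σ^{⊗ n}}(T^n) ≤ -R`, where `log 0 = -∞`. -/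
def steinExponent {ι : Type*} [Fintype ι] [DecidableEq ι] {Ω : ℕ → Type*} [∀ n, Fintype (Ω n)]
    (M : ∀ n, POVM (Ω n) (Fin n → ι)) (ρ σ : Matrix ι ι ℂ) : EReal :=
  sSup ((fun R : ℝ => (R : EReal)) '' {R : ℝ | ∃ T : ∀ n, Ω n → ℝ,
    (∀ n i, T n i ∈ Set.Icc (0 : ℝ) 1) ∧
    Tendsto (fun n => (M n).expect (tensorPow ρ n) (fun i => 1 - T n i)) atTop (𝓝 0) ∧
    limsup (fun n : ℕ => (((1 : ℝ) / n : ℝ) : EReal) *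
      ENNReal.log (ENNReal.ofReal ((M n).expect (tensorPow σ n) (T n)))) atTop
      ≤ ((-R : ℝ) : EReal)})

/-- The quantum relative entropy `D(ρ‖σ) = Tr ρ (log ρ - log σ)` for invertible `σ`; the value
`log 0 = 0` of the scalar function amounts to the convention `0 log 0 = 0` for `ρ`. -/
def quantumRelEntropy {d : Type*} [Fintype d] [DecidableEq d] (ρ σ : Matrix d d ℂ) : ℝ :=
  (ρ * (cfc Real.log ρ - cfc Real.log σ)).trace.re

/-- The random variables `-(1/n) log P^{M^n}_{σ^{⊗ n}}` converge to the constant `c` in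
probability under `P^{M^n}_{ρ^{⊗ n}}`. -/
def LogProbConverges {ι : Type*} [Fintype ι] [DecidableEq ι] {Ω : ℕ → Type*}
    [∀ n, Fintype (Ω n)] (M : ∀ n, POVM (Ω n) (Fin n → ι)) (ρ σ : Matrix ι ι ℂ) (c : ℝ) : Prop :=
  ∀ ε : ℝ, 0 < ε → Tendsto (fun n : ℕ => (M n).probOf (tensorPow ρ n)
    {i | ε < |-((1 : ℝ) / n) * Real.log ((M n).prob (tensorPow σ n) i) - c|}) atTop (𝓝 0)

namespace PVM

variable {Ω Ω' d : Type*} [Fintype Ω] [Fintype Ω'] [Fintype d] [DecidableEq d]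

/-- The operator `A` commutes with the PVM `E`. -/
def CommutesWith (E : PVM Ω d) (A : Matrix d d ℂ) : Prop :=
  ∀ i, A * E.elem i = E.elem i * A

/-- `w(E)`, the largest rank of an element of `E`. -/
def w (E : PVM Ω d) : ℕ :=
  Finset.univ.sup fun i => (E.elem i).rank

/-- `E ≤ F`: every element of `E` is a sum of elements of `F`. -/
def RefinedBy (E : PVM Ω d) (F : PVM Ω' d) : Prop :=
  ∀ i, ∃ S : Finset Ω', E.elem i = ∑ j ∈ S, F.elem j

/-- Finitely many projections summing up to the identity form a PVM. -/
def ofProj (P : Ω → Matrix d d ℂ) (hP : ∀ i, IsStarProjection (P i)) (h1 : ∑ i, P i = 1) :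
    PVM Ω d where
  elem := P
  posSemidef i := by
    have h := Matrix.posSemidef_conjTranspose_mul_self (P i)
    have h2 : (P i)ᴴ = P i := (hP i).isSelfAdjoint
    rwa [h2, (hP i).isIdempotentElem.eq] at h
  sum_eq_one := h1
  isStarProjection := hP

/-- The simultaneous measurement `E × F = {E_i F_j}` of two commuting PVMs. -/
def prod (E : PVM Ω d) (F : PVM Ω' d) (h : ∀ j, E.CommutesWith (F.elem j)) :
    PVM (Ω × Ω') d :=
  ofProj (fun p => E.elem p.1 * F.elem p.2)
    (fun p => (E.isStarProjection p.1).mul (F.isStarProjection p.2) (h p.2 p.1).symm)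
    (by rw [Fintype.sum_prod_type]
        simp only [← Finset.mul_sum, F.sum_eq_one, mul_one, E.sum_eq_one])

end PVM

instance instFintypeRealSpectrum {d : Type*} [Fintype d] [DecidableEq d] (A : Matrix d d ℂ) :
    Fintype (spectrum ℝ A) :=
  Fintype.ofFinite _

open Classical in
/-- The projection onto the eigenspace of the Hermitian matrix `A` for the eigenvalue `x`, as the
indicator function of `{x}` applied to `A`. -/
def eigenProj {d : Type*} [Fintype d] [DecidableEq d] (A : Matrix d d ℂ) (x : ℝ) :
    Matrix d d ℂ :=
  cfc (fun t : ℝ => if t = x then (1 : ℝ) else 0) A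

theorem eigenProj_isStarProjection {d : Type*} [Fintype d] [DecidableEq d] (A : Matrix d d ℂ)
    (x : ℝ) : IsStarProjection (eigenProj A x) where
  isIdempotentElem := by
    have hc : ContinuousOn (fun t : ℝ => if t = x then (1 : ℝ) else 0) (spectrum ℝ A) :=
      A.finite_real_spectrum.continuousOn _
    rw [IsIdempotentElem, eigenProj, ← cfc_mul _ _ A hc hc]
    congr 1
    funext t
    split_ifs <;> simp
  isSelfAdjoint := cfc_predicate _ A

theorem sum_eigenProj {d : Type*} [Fintype d] [DecidableEq d] {A : Matrix d d ℂ}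
    (hA : A.IsHermitian) : ∑ x : spectrum ℝ A, eigenProj A x = 1 := by
  classical
  have hA' : IsSelfAdjoint A := hA
  have hc : ∀ x : ℝ,
      ContinuousOn (fun t : ℝ => if t = x then (1 : ℝ) else 0) (spectrum ℝ A) :=
    fun x => A.finite_real_spectrum.continuousOn _
  rw [← cfc_const_one ℝ A]
  simp only [eigenProj]
  rw [← cfc_sum (fun x : spectrum ℝ A => fun t : ℝ => if t = (x : ℝ) then (1 : ℝ) else 0) A
    Finset.univ (fun x _ => hc x)]
  refine cfc_congr fun t ht => ?_
  rw [Finset.sum_apply, Finset.sum_eq_single (⟨t, ht⟩ : spectrum ℝ A)]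
  · simp
  · intro y _ hy
    exact if_neg fun h => hy (Subtype.ext h.symm)
  · simp

/-- The spectral decomposition `E(A)` of a Hermitian matrix `A`, regarded as a PVM: its elements
are the projections onto the eigenspaces of `A`. -/
def spectralPVM {d : Type*} [Fintype d] [DecidableEq d] (A : Matrix d d ℂ) (hA : A.IsHermitian) :
    PVM (spectrum ℝ A) d :=
  PVM.ofProj (fun x => eigenProj A x) (fun x => eigenProj_isStarProjection A x) (sum_eigenProj hA)

theorem PVM.CommutesWith.spectral {Ω d : Type*} [Fintype Ω] [Fintype d] [DecidableEq d]
    {E : PVM Ω d} {A : Matrix d d ℂ} (h : E.CommutesWith A) (hA : A.IsHermitian)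
    (x : spectrum ℝ A) : E.CommutesWith ((spectralPVM A hA).elem x) := by
  intro i
  have hA' : IsSelfAdjoint A := hA
  have hAE : Commute A (E.elem i) := h i
  exact hAE.cfc_real _

end

/-! Write `e = Tr ρ log ρ`, `s = Tr ρ log σ`, so that `D = e - s`, and let `p`, `q` be the outcome
distributions of `M^n` in the states `ρ^{⊗ n}`, `σ^{⊗ n}`. Everything is reduced to the typical
sizes of `p` and `q` under `p`.

Likelihood ratio tests are optimal up to an arbitrarily small loss in the exponent, and no
projective measurement exceeds `D`. Hence the exponent equals `D` iff for every `ε > 0` the event `p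
< exp (n (D - ε)) q` has vanishing `p`-probability (`steinExponent_eq_iff`).

Refining `E^n` forces `p ≥ exp (n (e - ε))` with high probability: each block commutes with the
state and holds only polynomially many nonzero elements, so an outcome of tiny probability captures
little of the typical part of the state (`PVM.sum_small_prob_le`). Elements of rank at most one
force `p ≤ exp (n (e + ε))`, because such an element sees at most the largest typical eigenvalue
(`POVM.sum_large_prob_le`). The typical eigenvalues are governed by the weak law of large numbers.

The strong converse (`tendsto_trace_of_trace_le_exp`) makes `p ≥ exp (n (D + ε)) q` improbable as
well. If the exponent is `D`, both `p` and `p / q` are therefore pinned to first order in the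
exponent, and so is `q ≈ exp (n s)`. Conversely, `q ≤ exp (n (s + ε))` and the lower bound for `p`
give the likelihood criterion.

If the elements consist of eigenvectors of `σ^{⊗ n}`, then `q` is an eigenvalue times a polynomially
bounded trace, and these eigenvalues are controlled by the law of large numbers for the diagonal of
`ρ` in an eigenbasis of `σ`. This covers both optimality claims, since a rank-one projection
commuting with `σ^{⊗ n}` projects onto an eigenvector. -/

noncomputable section

/-! ### Trace inequalities for positive semidefinite matrices. -/

section TraceInequalities

variable {d : Type*} [Fintype d]

open scoped MatrixOrder Matrix.Norms.L2Operator in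
theorem Matrix.PosSemidef.exists_conjTranspose_mul_self {A : Matrix d d ℂ} (hA : A.PosSemidef) :
    ∃ B : Matrix d d ℂ, A = Bᴴ * B := by
  classical
  obtain ⟨B, hB⟩ := (CStarAlgebra.nonneg_iff_eq_star_mul_self (a := A)).mp hA.nonneg
  exact ⟨B, hB⟩

theorem Matrix.trace_conjTranspose_mul_self_re {m n : Type*} [Fintype m] [Fintype n]
    (B : Matrix m n ℂ) : (Bᴴ * B).trace.re = ∑ y, ∑ x, ‖B x y‖ ^ 2 := by
  simp only [Matrix.trace, Matrix.diag_apply, Matrix.mul_apply, Matrix.conjTranspose_apply,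
    Complex.re_sum]
  refine Finset.sum_congr rfl fun y _ => Finset.sum_congr rfl fun x _ => ?_
  rw [Complex.star_def, ← Complex.normSq_eq_conj_mul_self, Complex.ofReal_re,
    Complex.normSq_eq_norm_sq]

theorem Matrix.PosSemidef.trace_mul_re_nonneg {A B : Matrix d d ℂ} (hA : A.PosSemidef)
    (hB : B.PosSemidef) : 0 ≤ (A * B).trace.re := by
  obtain ⟨X, rfl⟩ := hA.exists_conjTranspose_mul_self
  have h : (Xᴴ * X * B).trace = (X * B * Xᴴ).trace := by
    rw [Matrix.trace_mul_comm (X * B), Matrix.mul_assoc]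
  rw [h]
  exact (Complex.le_def.mp (hB.mul_mul_conjTranspose_same X).trace_nonneg).1

theorem Matrix.PosSemidef.trace_re_nonneg {A : Matrix d d ℂ} (hA : A.PosSemidef) :
    0 ≤ A.trace.re :=
  (Complex.le_def.mp hA.trace_nonneg).1

/-- With `A = XᴴX` and `B = YᴴY` the left side is the squared Frobenius norm of `X Yᴴ`, and this
norm is submultiplicative by Cauchy–Schwarz. -/
theorem Matrix.PosSemidef.trace_mul_re_le {A B : Matrix d d ℂ} (hA : A.PosSemidef)
    (hB : B.PosSemidef) : (A * B).trace.re ≤ A.trace.re * B.trace.re := by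
  obtain ⟨X, rfl⟩ := hA.exists_conjTranspose_mul_self
  obtain ⟨Y, rfl⟩ := hB.exists_conjTranspose_mul_self
  have h : (Xᴴ * X * (Yᴴ * Y)).trace = ((X * Yᴴ)ᴴ * (X * Yᴴ)).trace := by
    rw [Matrix.conjTranspose_mul, Matrix.conjTranspose_conjTranspose, Matrix.mul_assoc,
      Matrix.trace_mul_comm, Matrix.mul_assoc, Matrix.trace_mul_comm, Matrix.mul_assoc,
      Matrix.mul_assoc, Matrix.mul_assoc]
    rw [Matrix.trace_mul_comm]
    simp only [Matrix.mul_assoc]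
  rw [h]
  have h2 : (Yᴴ * Y).trace.re = ((Yᴴ)ᴴ * Yᴴ).trace.re := by
    rw [Matrix.conjTranspose_conjTranspose, Matrix.trace_mul_comm]
  rw [h2]
  simp only [Matrix.trace_conjTranspose_mul_self_re]
  have hX : ∀ x y, ‖(X * Yᴴ) x y‖ ^ 2 ≤ (∑ z, ‖X x z‖ ^ 2) * ∑ z, ‖Yᴴ z y‖ ^ 2 := by
    intro x y
    refine le_trans ?_ (Finset.sum_mul_sq_le_sq_mul_sq Finset.univ
      (fun z => ‖X x z‖) (fun z => ‖Yᴴ z y‖))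
    refine pow_le_pow_left₀ (norm_nonneg _) ?_ 2
    rw [Matrix.mul_apply]
    refine (norm_sum_le _ _).trans (le_of_eq ?_)
    simp
  calc ∑ y, ∑ x, ‖(X * Yᴴ) x y‖ ^ 2
      ≤ ∑ y, ∑ x, (∑ z, ‖X x z‖ ^ 2) * ∑ z, ‖Yᴴ z y‖ ^ 2 :=
        Finset.sum_le_sum fun y _ => Finset.sum_le_sum fun x _ => hX x y
    _ = (∑ y, ∑ x, ‖X x y‖ ^ 2) * ∑ y, ∑ x, ‖Yᴴ x y‖ ^ 2 := by
        rw [Finset.sum_comm (f := fun y x => ‖X x y‖ ^ 2), Finset.sum_mul_sum, Finset.sum_comm]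

end TraceInequalities

/-! ### Orthogonal projections: trace, rank, and the rank-one case. -/

section Projections

variable {d : Type*} [Fintype d]

theorem IsStarProjection.matrix_posSemidef {P : Matrix d d ℂ} (hP : IsStarProjection P) :
    P.PosSemidef := by
  have h := Matrix.posSemidef_conjTranspose_mul_self P
  have h2 : Pᴴ = P := hP.isSelfAdjoint
  rwa [h2, hP.isIdempotentElem.eq] at h

variable [DecidableEq d]

theorem IsIdempotentElem.matrix_trace_eq_rank {P : Matrix d d ℂ} (hP : IsIdempotentElem P) :
    P.trace = P.rank := by
  have h : IsIdempotentElem (Matrix.toLin' P) := by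
    rw [IsIdempotentElem, Module.End.mul_eq_comp, ← Matrix.toLin'_mul, hP.eq]
  have h2 := (LinearMap.isProj_range_iff_isIdempotentElem _).mpr h
  have h3 := h2.trace
  rw [Matrix.trace_toLin'_eq] at h3
  rw [h3]
  rfl

theorem IsIdempotentElem.matrix_trace_re_eq_rank {P : Matrix d d ℂ} (hP : IsIdempotentElem P) :
    P.trace.re = P.rank := by
  rw [hP.matrix_trace_eq_rank, Complex.natCast_re]

theorem IsStarProjection.rank_ne_zero {P : Matrix d d ℂ} (hP : IsStarProjection P)
    (h0 : P ≠ 0) : P.rank ≠ 0 := fun h =>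
  h0 (hP.matrix_posSemidef.trace_eq_zero_iff.mp (by
    rw [hP.isIdempotentElem.matrix_trace_eq_rank, h, Nat.cast_zero]))

theorem IsStarProjection.one_le_trace_re {P : Matrix d d ℂ} (hP : IsStarProjection P)
    (h0 : P ≠ 0) : 1 ≤ P.trace.re := by
  rw [hP.isIdempotentElem.matrix_trace_re_eq_rank]
  have := hP.rank_ne_zero h0
  exact_mod_cast Nat.one_le_iff_ne_zero.mpr this

/-- An operator commuting with a projection of rank at most one acts on its range as a scalar. -/
theorem IsStarProjection.exists_mul_eq_smul_of_rank_le_one {P A : Matrix d d ℂ}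
    (hP : IsStarProjection P) (hr : P.rank ≤ 1) (hA : A.IsHermitian) (hc : A * P = P * A) :
    ∃ c : ℝ, A * P = (c : ℂ) • P := by
  by_cases hP0 : P = 0
  · exact ⟨0, by simp [hP0]⟩
  obtain ⟨⟨v, hv⟩, hspan⟩ := finrank_le_one_iff.mp hr
  have hPv : P *ᵥ v = v := by
    obtain ⟨w, rfl⟩ := hv
    simp [Matrix.mulVec_mulVec, hP.isIdempotentElem.eq]
  have hs : ∀ w, ∃ c : ℂ, P *ᵥ w = c • v := fun w => by
    obtain ⟨c, hc⟩ := hspan ⟨P *ᵥ w, w, rfl⟩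
    exact ⟨c, (congrArg Subtype.val hc).symm⟩
  obtain ⟨ν, hν⟩ := hs (A *ᵥ v)
  have hAv : A *ᵥ v = ν • v := by
    rw [← hν, Matrix.mulVec_mulVec, ← hc, ← Matrix.mulVec_mulVec, hPv]
  have hAP : A * P = ν • P := by
    refine Matrix.toLin'.injective (LinearMap.ext fun w => ?_)
    obtain ⟨c, hcw⟩ := hs w
    simp only [Matrix.toLin'_apply, ← Matrix.mulVec_mulVec, Matrix.smul_mulVec, hcw,
      Matrix.mulVec_smul, hAv]
    rw [smul_comm]
  have htr : (A * P).trace = ν * P.rank := by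
    rw [hAP, Matrix.trace_smul, hP.isIdempotentElem.matrix_trace_eq_rank, smul_eq_mul]
  -- The scalar `ν` is real because `ν · rank P = Tr A P` is the trace of a Hermitian matrix.
  have hreal : star (A * P).trace = (A * P).trace := by
    have hPs : Pᴴ = P := hP.isSelfAdjoint
    rw [← Matrix.trace_conjTranspose, Matrix.conjTranspose_mul, hPs, hA.eq, hc]
  have hrank : (P.rank : ℂ) ≠ 0 := by
    exact_mod_cast hP.rank_ne_zero hP0
  rw [htr, star_mul', star_natCast] at hreal
  refine ⟨ν.re, ?_⟩
  rw [Complex.conj_eq_iff_re.mp (mul_right_cancel₀ hrank hreal), hAP]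

end Projections

/-! ### Orthogonality inside a PVM, refinements, outcome probabilities. -/

namespace PVM

variable {Ω Ω' d : Type*} [Fintype Ω] [Fintype Ω'] [Fintype d] [DecidableEq d]

theorem elem_conjTranspose (M : PVM Ω d) (i : Ω) : (M.elem i)ᴴ = M.elem i :=
  (M.isStarProjection i).isSelfAdjoint

theorem elem_mul_self (M : PVM Ω d) (i : Ω) : M.elem i * M.elem i = M.elem i :=
  (M.isStarProjection i).isIdempotentElem.eq

/-- The numbers `Tr M_i M_k M_i = ‖M_k M_i‖²` (Frobenius norm) sum over `k` to `Tr M_i`, which the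
term `k = i` already exhausts. -/
theorem elem_mul_elem_of_ne (M : PVM Ω d) {i k : Ω} (hik : k ≠ i) :
    M.elem k * M.elem i = 0 := by
  classical
  have hsum : ∑ k, (M.elem i * M.elem k * M.elem i).trace.re = (M.elem i).trace.re := by
    rw [← Complex.re_sum, ← Matrix.trace_sum, ← Finset.sum_mul, ← Finset.mul_sum, M.sum_eq_one,
      mul_one, M.elem_mul_self]
  have hform : ∀ k, M.elem i * M.elem k * M.elem i
      = (M.elem k * M.elem i)ᴴ * (M.elem k * M.elem i) := fun k => by
    rw [Matrix.conjTranspose_mul, M.elem_conjTranspose, M.elem_conjTranspose]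
    calc M.elem i * M.elem k * M.elem i = M.elem i * (M.elem k * M.elem k) * M.elem i := by
          rw [M.elem_mul_self]
      _ = _ := by simp only [Matrix.mul_assoc]
  have hnn : ∀ k, 0 ≤ (M.elem i * M.elem k * M.elem i).trace.re := fun k => by
    rw [hform]
    exact (Matrix.posSemidef_conjTranspose_mul_self _).trace_re_nonneg
  rw [← Finset.add_sum_erase _ _ (Finset.mem_univ i), M.elem_mul_self, M.elem_mul_self] at hsum
  have h0 : ∑ k ∈ Finset.univ.erase i, (M.elem i * M.elem k * M.elem i).trace.re = 0 := by
    linarith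
  have hk := (Finset.sum_eq_zero_iff_of_nonneg fun k _ => hnn k).mp h0 k
    (Finset.mem_erase.mpr ⟨hik, Finset.mem_univ k⟩)
  rw [hform, Matrix.trace_conjTranspose_mul_self_re] at hk
  ext x y
  have h1 := (Finset.sum_eq_zero_iff_of_nonneg fun y _ =>
    Finset.sum_nonneg fun x _ => sq_nonneg _).mp hk y (Finset.mem_univ y)
  have h2 := (Finset.sum_eq_zero_iff_of_nonneg fun x _ => sq_nonneg _).mp h1 x
    (Finset.mem_univ x)
  simpa using h2

theorem elem_mul_sum (M : PVM Ω d) [DecidableEq Ω] (i : Ω) (S : Finset Ω) :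
    M.elem i * ∑ k ∈ S, M.elem k = if i ∈ S then M.elem i else 0 := by
  rw [Finset.mul_sum]
  split_ifs with h
  · rw [Finset.sum_eq_single_of_mem i h fun k _ hk => M.elem_mul_elem_of_ne hk.symm,
      M.elem_mul_self]
  · exact Finset.sum_eq_zero fun k hk => M.elem_mul_elem_of_ne fun e => h (e ▸ hk)

theorem isStarProjection_sum (M : PVM Ω d) (S : Finset Ω) :
    IsStarProjection (∑ k ∈ S, M.elem k) where
  isIdempotentElem := by
    classical
    rw [IsIdempotentElem, Finset.sum_mul]
    exact Finset.sum_congr rfl fun k hk => by rw [M.elem_mul_sum, if_pos hk]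
  isSelfAdjoint := by
    rw [IsSelfAdjoint, star_sum]
    exact Finset.sum_congr rfl fun k _ => M.elem_conjTranspose k

theorem rank_elem_le_w (M : PVM Ω d) (i : Ω) : (M.elem i).rank ≤ M.w :=
  Finset.le_sup (f := fun i => (M.elem i).rank) (Finset.mem_univ i)

/-- A nonzero element of `M` overlaps some block of `E`; by orthogonality it is one of the summands
of that block. -/
theorem trace_re_le_of_refinedBy {E : PVM Ω d} {M : PVM Ω' d} (h : E.RefinedBy M) (k : Ω') :
    (M.elem k).trace.re ≤ E.w := by
  classical
  by_cases h0 : M.elem k = 0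
  · simp [h0]
  obtain ⟨i, hi⟩ : ∃ i, M.elem k * E.elem i ≠ 0 := by
    by_contra! hcon
    apply h0
    rw [← mul_one (M.elem k), ← E.sum_eq_one, Finset.mul_sum]
    exact Finset.sum_eq_zero fun i _ => hcon i
  obtain ⟨S, hS⟩ := h i
  have hk : k ∈ S := by
    by_contra hk
    rw [hS, M.elem_mul_sum, if_neg hk] at hi
    exact hi rfl
  calc (M.elem k).trace.re ≤ ∑ j ∈ S, (M.elem j).trace.re :=
        Finset.single_le_sum (f := fun j => (M.elem j).trace.re)
          (fun j _ => (M.posSemidef j).trace_re_nonneg) hk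
    _ = (E.elem i).trace.re := by rw [hS, Matrix.trace_sum, Complex.re_sum]
    _ = (E.elem i).rank := (E.isStarProjection i).isIdempotentElem.matrix_trace_re_eq_rank
    _ ≤ E.w := by exact_mod_cast E.rank_elem_le_w i

end PVM

namespace POVM

variable {Ω d : Type*} [Fintype Ω] [Fintype d] [DecidableEq d]

theorem prob_nonneg (M : POVM Ω d) {ρ : Matrix d d ℂ} (hρ : ρ.PosSemidef) (i : Ω) :
    0 ≤ M.prob ρ i :=
  (M.posSemidef i).trace_mul_re_nonneg hρ

theorem sum_prob (M : POVM Ω d) (ρ : Matrix d d ℂ) : ∑ i, M.prob ρ i = ρ.trace.re := by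
  simp only [POVM.prob]
  rw [← Complex.re_sum, ← Matrix.trace_sum, ← Finset.sum_mul, M.sum_eq_one, one_mul]

theorem sum_prob_finset (M : POVM Ω d) (ρ : Matrix d d ℂ) (S : Finset Ω) :
    ∑ i ∈ S, M.prob ρ i = ((∑ i ∈ S, M.elem i) * ρ).trace.re := by
  simp only [POVM.prob]
  rw [← Complex.re_sum, ← Matrix.trace_sum, ← Finset.sum_mul]

end POVM

/-! ### Calculus in a fixed orthonormal eigenbasis. -/

/-- The operator with eigenvalues `f` in the orthonormal basis given by the columns of `U`. -/
def unitaryDiag {d : Type*} [Fintype d] [DecidableEq d] (U : Matrix d d ℂ) (f : d → ℝ) :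
    Matrix d d ℂ :=
  U * Matrix.diagonal (fun i => (f i : ℂ)) * Uᴴ

section UnitaryDiag

variable {d : Type*} [Fintype d] {U : Matrix d d ℂ}

theorem conj_diag_re_nonneg {A : Matrix d d ℂ} (hA : A.PosSemidef) (x : d) :
    0 ≤ ((Uᴴ * A * U) x x).re :=
  (Complex.le_def.mp ((hA.conjTranspose_mul_mul_same U).diag_nonneg (i := x))).1

variable [DecidableEq d]

theorem unitaryDiag_mul (hU : Uᴴ * U = 1) (f g : d → ℝ) :
    unitaryDiag U f * unitaryDiag U g = unitaryDiag U (fun x => f x * g x) := by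
  simp only [unitaryDiag]
  rw [show U * diagonal (fun i => (f i : ℂ)) * Uᴴ * (U * diagonal (fun i => (g i : ℂ)) * Uᴴ)
    = U * diagonal (fun i => (f i : ℂ)) * (Uᴴ * U) * diagonal (fun i => (g i : ℂ)) * Uᴴ by
      simp only [Matrix.mul_assoc], hU, Matrix.mul_one, Matrix.mul_assoc U, diagonal_mul_diagonal]
  simp

theorem unitaryDiag_conjTranspose (f : d → ℝ) : (unitaryDiag U f)ᴴ = unitaryDiag U f := by
  simp only [unitaryDiag, conjTranspose_mul, conjTranspose_conjTranspose,
    diagonal_conjTranspose, Matrix.mul_assoc]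
  congr 3
  ext i
  simp

theorem unitaryDiag_posSemidef {f : d → ℝ} (hf : ∀ x, 0 ≤ f x) :
    (unitaryDiag U f).PosSemidef := by
  refine Matrix.PosSemidef.mul_mul_conjTranspose_same (Matrix.PosSemidef.diagonal fun i => ?_) U
  change (0 : ℂ) ≤ (f i : ℂ)
  exact_mod_cast hf i

theorem trace_mul_unitaryDiag_re (A : Matrix d d ℂ) (f : d → ℝ) :
    (A * unitaryDiag U f).trace.re = ∑ x, f x * ((Uᴴ * A * U) x x).re := by
  rw [unitaryDiag, ← Matrix.mul_assoc, Matrix.trace_mul_comm, ← Matrix.mul_assoc,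
    ← Matrix.mul_assoc, Matrix.trace, Complex.re_sum]
  refine Finset.sum_congr rfl fun x _ => ?_
  rw [diag_apply, mul_diagonal, Complex.re_mul_ofReal, mul_comm]

theorem unitaryDiag_trace_re (hU : Uᴴ * U = 1) (f : d → ℝ) :
    (unitaryDiag U f).trace.re = ∑ x, f x := by
  have h := trace_mul_unitaryDiag_re (U := U) 1 f
  rw [Matrix.one_mul, Matrix.mul_one, hU] at h
  simpa using h

theorem unitaryDiag_comm_apply (hU : Uᴴ * U = 1) (hU' : U * Uᴴ = 1) {A : Matrix d d ℂ}
    {f : d → ℝ} :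
    unitaryDiag U f * A = A * unitaryDiag U f ↔
      ∀ x y, (f x : ℂ) * (Uᴴ * A * U) x y = (Uᴴ * A * U) x y * f y := by
  have key : ∀ x y, (Uᴴ * (unitaryDiag U f * A) * U) x y = (f x : ℂ) * (Uᴴ * A * U) x y := by
    intro x y
    have : Uᴴ * (unitaryDiag U f * A) * U
        = (Uᴴ * U) * (diagonal (fun i => (f i : ℂ)) * (Uᴴ * A * U)) := by
      simp only [unitaryDiag, Matrix.mul_assoc]
    rw [this, hU, Matrix.one_mul, diagonal_mul]
  have key' : ∀ x y, (Uᴴ * (A * unitaryDiag U f) * U) x y = (Uᴴ * A * U) x y * (f y : ℂ) := by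
    intro x y
    have : Uᴴ * (A * unitaryDiag U f) * U
        = (Uᴴ * A * U) * diagonal (fun i => (f i : ℂ)) * (Uᴴ * U) := by
      simp only [unitaryDiag, Matrix.mul_assoc]
    rw [this, hU, Matrix.mul_one, mul_diagonal]
  constructor
  · intro h x y
    rw [← key, h, key']
  · intro h
    have h2 : Uᴴ * (unitaryDiag U f * A) * U = Uᴴ * (A * unitaryDiag U f) * U := by
      ext x y
      rw [key, key', h]
    have h3 := congrArg (fun X => U * X * Uᴴ) h2
    have h4 : ∀ X : Matrix d d ℂ, U * (Uᴴ * X * U) * Uᴴ = X := fun X => by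
      rw [show U * (Uᴴ * X * U) * Uᴴ = (U * Uᴴ) * X * (U * Uᴴ) by simp only [Matrix.mul_assoc],
        hU', Matrix.one_mul, Matrix.mul_one]
    simpa only [h4] using h3

/-- Commuting means that the matrix entries between distinct eigenvalues vanish, and applying `φ`
only merges eigenvalues. -/
theorem unitaryDiag_comm_comp (hU : Uᴴ * U = 1) (hU' : U * Uᴴ = 1) {A : Matrix d d ℂ}
    {f : d → ℝ} (φ : ℝ → ℝ) (h : unitaryDiag U f * A = A * unitaryDiag U f) :
    unitaryDiag U (fun x => φ (f x)) * A = A * unitaryDiag U (fun x => φ (f x)) := by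
  rw [unitaryDiag_comm_apply hU hU'] at h ⊢
  intro x y
  have h1 : ((f x : ℂ) - f y) * (Uᴴ * A * U) x y = 0 := by
    rw [sub_mul, h x y]; ring
  rcases mul_eq_zero.mp h1 with h2 | h2
  · have : f x = f y := by exact_mod_cast sub_eq_zero.mp h2
    rw [this, mul_comm]
  · rw [h2, mul_zero, zero_mul]

end UnitaryDiag

/-! ### Outcomes of small probability. -/

section SmallProbabilities

open Classical in
/-- If `M` refines a PVM `E` commuting with the state, then the outcomes of `M` of probability at
most `τ` have small total probability unless the state has many eigenvalues below `L ≫ w(E) τ`. -/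
theorem PVM.sum_small_prob_le {Ω Ω' d : Type*} [Fintype Ω] [Fintype Ω'] [Fintype d]
    [DecidableEq d] {E : PVM Ω d} {M : PVM Ω' d} (h : E.RefinedBy M)
    {U : Matrix d d ℂ} (hU : Uᴴ * U = 1) (hU' : U * Uᴴ = 1) {lam : d → ℝ}
    (hlam : ∀ x, 0 ≤ lam x) (hsum : ∑ x, lam x = 1)
    (hE : E.CommutesWith (unitaryDiag U lam)) {L τ : ℝ} (hL : 0 < L) (hτ : 0 ≤ τ) :
    ∑ i with M.prob (unitaryDiag U lam) i ≤ τ, M.prob (unitaryDiag U lam) i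
      ≤ ∑ x with lam x < L, lam x + E.w * τ / L := by
  set ρ := unitaryDiag U lam with hρ
  set p : d → ℝ := fun x => if lam x < L then 0 else 1 with hp
  set Q := unitaryDiag U p with hQ
  have hQQ : Q * Q = Q := by
    rw [hQ, unitaryDiag_mul hU]
    congr 1
    funext x
    simp only [hp]; split_ifs <;> norm_num
  have hQs : Qᴴ = Q := unitaryDiag_conjTranspose p
  have hQρ : Q * ρ = ρ * Q := by
    rw [hQ, hρ, unitaryDiag_mul hU, unitaryDiag_mul hU]
    simp only [mul_comm]
  have hQE : ∀ j, Q * E.elem j = E.elem j * Q := fun j =>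
    unitaryDiag_comm_comp hU hU' (fun t => if t < L then 0 else 1) (hE j)
  have hρp : ρ.PosSemidef := unitaryDiag_posSemidef hlam
  -- the part of the state in block `j` and above the threshold
  set K : Ω → Matrix d d ℂ := fun j => E.elem j * ρ * Q with hK
  have hKform : ∀ j, K j = (E.elem j * Q) * ρ * (E.elem j * Q)ᴴ := fun j => by
    rw [conjTranspose_mul, hQs, E.elem_conjTranspose, ← hQE j]
    calc E.elem j * ρ * Q = (E.elem j * E.elem j) * ρ * (Q * Q) := by
          rw [E.elem_mul_self, hQQ]
      _ = E.elem j * (ρ * E.elem j) * (Q * Q) := by rw [hE j]; simp only [Matrix.mul_assoc]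
      _ = E.elem j * ρ * (E.elem j * Q) * Q := by simp only [Matrix.mul_assoc]
      _ = E.elem j * (ρ * Q) * E.elem j * Q := by rw [← hQE j]; simp only [Matrix.mul_assoc]
      _ = (E.elem j * Q) * ρ * (E.elem j * Q) := by rw [← hQρ]; simp only [Matrix.mul_assoc]
      _ = (Q * E.elem j) * ρ * (Q * E.elem j) := by rw [← hQE j]
  have hKp : ∀ j, (K j).PosSemidef := fun j => by
    rw [hKform]
    exact hρp.mul_mul_conjTranspose_same _
  have hKQ : ∀ j, Q * K j * Q = K j := fun j => by
    simp only [hK]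
    calc Q * (E.elem j * ρ * Q) * Q = (Q * E.elem j) * ρ * (Q * Q) := by
          simp only [Matrix.mul_assoc]
      _ = E.elem j * (Q * ρ) * Q := by rw [hQE, hQQ]; simp only [Matrix.mul_assoc]
      _ = E.elem j * ρ * (Q * Q) := by rw [hQρ]; simp only [Matrix.mul_assoc]
      _ = E.elem j * ρ * Q := by rw [hQQ]
  have hc0 : ∀ i x, 0 ≤ ((Uᴴ * M.elem i * U) x x).re := fun i x =>
    conj_diag_re_nonneg (M.posSemidef i) x
  -- This is `L Q ≤ ρ`: the state is at least `L` on the range of `Q`.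
  have hMQ : ∀ i, L * (M.elem i * Q).trace.re ≤ M.prob ρ i := fun i => by
    rw [POVM.prob, hQ, hρ, trace_mul_unitaryDiag_re, trace_mul_unitaryDiag_re, Finset.mul_sum]
    refine Finset.sum_le_sum fun x _ => ?_
    rw [← mul_assoc]
    refine mul_le_mul_of_nonneg_right ?_ (hc0 i x)
    simp only [hp]
    split_ifs with hx
    · simpa using hlam x
    · simpa using not_lt.mp hx
  -- `K j` lives on the range of `Q`, so `M_i` may be replaced by `Q M_i Q`, whose trace is at most
  -- `τ / L`; then `Tr A B ≤ Tr A · Tr B` applies.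
  have hMK : ∀ i j, M.prob ρ i ≤ τ →
      (M.elem i * K j).trace.re ≤ τ / L * (K j).trace.re := fun i j hi => by
    have h1 : (M.elem i * K j).trace = (Q * M.elem i * Qᴴ * K j).trace := by
      rw [hQs]
      calc (M.elem i * K j).trace = ((M.elem i * Q * K j) * Q).trace := by
            conv_lhs => rw [← hKQ j]
            simp only [Matrix.mul_assoc]
        _ = _ := by
            rw [Matrix.trace_mul_comm]
            simp only [Matrix.mul_assoc]
    have h2 : (Q * M.elem i * Qᴴ).trace = (M.elem i * Q).trace := by
      rw [hQs, Matrix.trace_mul_comm, ← Matrix.mul_assoc, hQQ, Matrix.trace_mul_comm]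
    rw [h1]
    refine (((M.posSemidef i).mul_mul_conjTranspose_same Q).trace_mul_re_le (hKp j)).trans ?_
    rw [h2]
    refine mul_le_mul_of_nonneg_right ?_ (hKp j).trace_re_nonneg
    rw [le_div_iff₀ hL, mul_comm]
    exact (hMQ i).trans hi
  set S : Finset Ω' := Finset.univ.filter fun i => M.prob ρ i ≤ τ with hS
  have hblock : ∀ j, ∑ i ∈ S, (M.elem i * K j).trace.re
      ≤ E.w * τ / L * (K j).trace.re := fun j => by
    obtain ⟨R, hR⟩ := h j
    have hz : ∀ i ∈ S, i ∉ R.filter (fun i => M.elem i ≠ 0) → (M.elem i * K j).trace.re = 0 := by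
      intro i _ hiR
      have : M.elem i * E.elem j = 0 := by
        rw [hR, M.elem_mul_sum]
        split_ifs with hi
        · by_contra h0
          exact hiR (Finset.mem_filter.mpr ⟨hi, h0⟩)
        · rfl
      simp only [hK]
      rw [← Matrix.mul_assoc, ← Matrix.mul_assoc, this]
      simp
    -- Each nonzero projection has trace at least one, so a block has at most `rank E_j` nonzero
    -- summands.
    have hcard : ((R.filter fun i => M.elem i ≠ 0).card : ℝ) ≤ E.w := by
      calc ((R.filter fun i => M.elem i ≠ 0).card : ℝ)
          = ∑ i ∈ R.filter fun i => M.elem i ≠ 0, (1 : ℝ) := by simp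
        _ ≤ ∑ i ∈ R.filter fun i => M.elem i ≠ 0, (M.elem i).trace.re :=
          Finset.sum_le_sum fun i hi =>
            (M.isStarProjection i).one_le_trace_re (Finset.mem_filter.mp hi).2
        _ ≤ ∑ i ∈ R, (M.elem i).trace.re :=
          Finset.sum_le_sum_of_subset_of_nonneg (Finset.filter_subset _ _)
            fun i _ _ => (M.posSemidef i).trace_re_nonneg
        _ = (E.elem j).trace.re := by rw [hR, Matrix.trace_sum, Complex.re_sum]
        _ = (E.elem j).rank := (E.isStarProjection j).isIdempotentElem.matrix_trace_re_eq_rank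
        _ ≤ E.w := by exact_mod_cast E.rank_elem_le_w j
    have hb : 0 ≤ τ / L * (K j).trace.re :=
      mul_nonneg (div_nonneg hτ hL.le) (hKp j).trace_re_nonneg
    calc ∑ i ∈ S, (M.elem i * K j).trace.re
        = ∑ i ∈ S ∩ R.filter (fun i => M.elem i ≠ 0), (M.elem i * K j).trace.re := by
          refine (Finset.sum_subset Finset.inter_subset_left fun i hi hni => hz i hi ?_).symm
          exact fun hc => hni (Finset.mem_inter.mpr ⟨hi, hc⟩)
      _ ≤ ∑ i ∈ S ∩ R.filter (fun i => M.elem i ≠ 0), τ / L * (K j).trace.re :=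
          Finset.sum_le_sum fun i hi =>
            hMK i j (Finset.mem_filter.mp (Finset.mem_inter.mp hi).1).2
      _ = (S ∩ R.filter (fun i => M.elem i ≠ 0)).card * (τ / L * (K j).trace.re) := by
          rw [Finset.sum_const, nsmul_eq_mul]
      _ ≤ E.w * (τ / L * (K j).trace.re) := by
          refine mul_le_mul_of_nonneg_right (le_trans ?_ hcard) hb
          exact_mod_cast Finset.card_le_card Finset.inter_subset_right
      _ = E.w * τ / L * (K j).trace.re := by ring
  have hKsum : ∑ j, K j = ρ * Q := by
    simp only [hK]
    rw [← Finset.sum_mul, ← Finset.sum_mul, E.sum_eq_one, Matrix.one_mul]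
  have hρQ : (ρ * Q).trace.re ≤ 1 := by
    rw [hρ, hQ, unitaryDiag_mul hU, unitaryDiag_trace_re hU, ← hsum]
    refine Finset.sum_le_sum fun x _ => mul_le_of_le_one_right (hlam x) ?_
    simp only [hp]; split_ifs <;> norm_num
  have hhigh : ∑ i ∈ S, (M.elem i * (ρ * Q)).trace.re ≤ E.w * τ / L := by
    calc ∑ i ∈ S, (M.elem i * (ρ * Q)).trace.re
        = ∑ j, ∑ i ∈ S, (M.elem i * K j).trace.re := by
          rw [Finset.sum_comm, ← hKsum]
          refine Finset.sum_congr rfl fun i _ => ?_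
          rw [Finset.mul_sum, Matrix.trace_sum, Complex.re_sum]
      _ ≤ ∑ j, E.w * τ / L * (K j).trace.re := Finset.sum_le_sum fun j _ => hblock j
      _ = E.w * τ / L * (ρ * Q).trace.re := by
          rw [← Finset.mul_sum, ← Complex.re_sum, ← Matrix.trace_sum, hKsum]
      _ ≤ E.w * τ / L := mul_le_of_le_one_right (by positivity) hρQ
  -- the part of the state below the threshold
  set q : d → ℝ := fun x => if lam x < L then lam x else 0 with hq
  have hsplit : ρ = unitaryDiag U q + ρ * Q := by
    rw [hρ, hQ, unitaryDiag_mul hU]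
    simp only [unitaryDiag]
    rw [← Matrix.add_mul, ← Matrix.mul_add, diagonal_add]
    congr 3
    funext x
    simp only [hq, hp]
    split_ifs <;> simp
  have hq0 : ∀ x, 0 ≤ q x := fun x => by
    simp only [hq]; split_ifs
    · exact hlam x
    · exact le_rfl
  have hlow : ∑ i ∈ S, (M.elem i * unitaryDiag U q).trace.re ≤ ∑ x with lam x < L, lam x := by
    calc ∑ i ∈ S, (M.elem i * unitaryDiag U q).trace.re
        ≤ ∑ i, (M.elem i * unitaryDiag U q).trace.re :=
          Finset.sum_le_sum_of_subset_of_nonneg (Finset.subset_univ _) fun i _ _ =>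
            (M.posSemidef i).trace_mul_re_nonneg (unitaryDiag_posSemidef hq0)
      _ = (unitaryDiag U q).trace.re := M.toPOVM.sum_prob _
      _ = ∑ x with lam x < L, lam x := by
          rw [unitaryDiag_trace_re hU, Finset.sum_filter]
  calc ∑ i ∈ S, M.prob ρ i
      = ∑ i ∈ S, ((M.elem i * unitaryDiag U q).trace.re + (M.elem i * (ρ * Q)).trace.re) := by
        refine Finset.sum_congr rfl fun i _ => ?_
        rw [POVM.prob]
        conv_lhs => rw [hsplit]
        rw [Matrix.mul_add, Matrix.trace_add, Complex.add_re]
    _ ≤ _ := by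
        rw [Finset.sum_add_distrib]
        exact add_le_add hlow hhigh

end SmallProbabilities

/-! ### Outcomes of large probability. -/

section LargeProbabilities

open Classical in
/-- If the elements of `M` have trace at most one, then the outcomes of probability at least `τ`
have small total probability unless the state has many eigenvalues above `L ≪ τ`. -/
theorem POVM.sum_large_prob_le {Ω d : Type*} [Fintype Ω] [Fintype d] [DecidableEq d]
    (M : POVM Ω d) (hM : ∀ i, (M.elem i).trace.re ≤ 1)
    {U : Matrix d d ℂ} (hU : Uᴴ * U = 1) (hU' : U * Uᴴ = 1) {lam : d → ℝ}
    (hlam : ∀ x, 0 ≤ lam x) (hsum : ∑ x, lam x = 1) {L τ : ℝ} (hL : 0 ≤ L) (hτ : 0 < τ) :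
    ∑ i with τ ≤ M.prob (unitaryDiag U lam) i, M.prob (unitaryDiag U lam) i
      ≤ ∑ x with L < lam x, lam x + L / τ := by
  set c : Ω → d → ℝ := fun i x => ((Uᴴ * M.elem i * U) x x).re with hc
  have hc0 : ∀ i x, 0 ≤ c i x := fun i x => conj_diag_re_nonneg (M.posSemidef i) x
  have hcx : ∀ x, ∑ i, c i x = 1 := fun x => by
    simp only [hc]
    rw [← Complex.re_sum, ← Matrix.sum_apply, ← Finset.sum_mul, ← Finset.mul_sum,
      M.sum_eq_one, Matrix.mul_one, hU]
    simp
  have hci : ∀ i, ∑ x, c i x ≤ 1 := fun i => by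
    refine le_trans (le_of_eq ?_) (hM i)
    simp only [hc]
    rw [← Complex.re_sum]
    change (Uᴴ * M.elem i * U).trace.re = _
    rw [Matrix.trace_mul_comm, ← Matrix.mul_assoc, hU', Matrix.one_mul]
  have hprob : ∀ i, M.prob (unitaryDiag U lam) i = ∑ x, lam x * c i x := fun i =>
    trace_mul_unitaryDiag_re _ _
  set S : Finset Ω := Finset.univ.filter fun i => τ ≤ M.prob (unitaryDiag U lam) i with hS
  -- Probabilities sum to one, so at most `1 / τ` of them reach `τ`.
  have hcard : (S.card : ℝ) ≤ 1 / τ := by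
    rw [le_div_iff₀ hτ]
    calc (S.card : ℝ) * τ = ∑ i ∈ S, τ := by rw [Finset.sum_const, nsmul_eq_mul]
      _ ≤ ∑ i ∈ S, M.prob (unitaryDiag U lam) i :=
        Finset.sum_le_sum fun i hi => (Finset.mem_filter.mp hi).2
      _ ≤ ∑ i, M.prob (unitaryDiag U lam) i :=
        Finset.sum_le_sum_of_subset_of_nonneg (Finset.subset_univ _) fun i _ _ =>
          M.prob_nonneg (unitaryDiag_posSemidef hlam) i
      _ = 1 := by rw [M.sum_prob, unitaryDiag_trace_re hU, hsum]
  -- Eigenvalues up to `L` contribute at most `L · Tr M_i ≤ L`.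
  have hi : ∀ i, M.prob (unitaryDiag U lam) i ≤ ∑ x with L < lam x, lam x * c i x + L := by
    intro i
    rw [hprob, ← Finset.sum_filter_add_sum_filter_not Finset.univ (fun x => L < lam x)]
    refine add_le_add le_rfl ?_
    calc ∑ x with ¬ L < lam x, lam x * c i x ≤ ∑ x with ¬ L < lam x, L * c i x :=
          Finset.sum_le_sum fun x hx => mul_le_mul_of_nonneg_right
            (not_lt.mp (Finset.mem_filter.mp hx).2) (hc0 i x)
      _ ≤ ∑ x, L * c i x :=
          Finset.sum_le_sum_of_subset_of_nonneg (Finset.subset_univ _) fun x _ _ =>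
            mul_nonneg hL (hc0 i x)
      _ ≤ L := by
          rw [← Finset.mul_sum]
          exact mul_le_of_le_one_right hL (hci i)
  calc ∑ i ∈ S, M.prob (unitaryDiag U lam) i
      ≤ ∑ i ∈ S, (∑ x with L < lam x, lam x * c i x + L) := Finset.sum_le_sum fun i _ => hi i
    _ = ∑ i ∈ S, ∑ x with L < lam x, lam x * c i x + S.card * L := by
        rw [Finset.sum_add_distrib, Finset.sum_const, nsmul_eq_mul]
    _ ≤ ∑ x with L < lam x, lam x + L / τ := by
        refine add_le_add ?_ ?_
        · rw [Finset.sum_comm]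
          refine Finset.sum_le_sum fun x _ => ?_
          rw [← Finset.mul_sum]
          refine mul_le_of_le_one_right (hlam x) ?_
          rw [← hcx x]
          exact Finset.sum_le_sum_of_subset_of_nonneg (Finset.subset_univ _) fun i _ _ => hc0 i x
        · rw [div_eq_mul_one_div, mul_comm]
          exact mul_le_mul_of_nonneg_left hcard hL

end LargeProbabilities

/-! ### The one-shot inequality behind the strong converse. -/

section StrongConverse

variable {d : Type*} [Fintype d] [DecidableEq d]

/-- The difference of the sides after the triangle inequality is `(t ‖a‖ - ‖b‖)² / t`. The free
weight matters: `t = 1` would only bound the limiting acceptance probability by `1/2`, while large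
`t` drives it to zero. -/
theorem norm_add_sq_le_weighted (a b : ℂ) {t : ℝ} (ht : 0 < t) :
    ‖a + b‖ ^ 2 ≤ (1 + t) * ‖a‖ ^ 2 + (1 + 1 / t) * ‖b‖ ^ 2 := by
  have h1 : ‖a + b‖ ^ 2 ≤ (‖a‖ + ‖b‖) ^ 2 :=
    pow_le_pow_left₀ (norm_nonneg _) (norm_add_le a b) 2
  have h2 : (1 + t) * ‖a‖ ^ 2 + (1 + 1 / t) * ‖b‖ ^ 2 - (‖a‖ + ‖b‖) ^ 2
      = (t * ‖a‖ - ‖b‖) ^ 2 / t := by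
    field_simp
    ring
  have h3 : 0 ≤ (t * ‖a‖ - ‖b‖) ^ 2 / t := by positivity
  linarith

/-- The two error probabilities of a projective test dominate those for the classical
distributions `λ_x |⟨u_x, v_y⟩|²` and `μ_y |⟨u_x, v_y⟩|²` of Nussbaum and Szkoła. -/
theorem sum_overlap_min_le {U V P : Matrix d d ℂ}
    (hU' : U * Uᴴ = 1) (hV' : V * Vᴴ = 1)
    {lam mu : d → ℝ} (hlam : ∀ x, 0 ≤ lam x) (hmu : ∀ y, 0 ≤ mu y) (hP : IsStarProjection P)
    {b t : ℝ} (hb : 0 ≤ b) (ht : 0 < t) :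
    ∑ x, ∑ y, ‖(Uᴴ * V) x y‖ ^ 2 * min (lam x) (b * mu y)
      ≤ (1 + t) * b * (P * unitaryDiag V mu).trace.re
        + (1 + 1 / t) * ((1 - P) * unitaryDiag U lam).trace.re := by
  have hPP := hP.isIdempotentElem.eq
  have hPs : Pᴴ = P := hP.isSelfAdjoint
  have hQQ := hP.one_sub.isIdempotentElem.eq
  have hQs : (1 - P)ᴴ = 1 - P := hP.one_sub.isSelfAdjoint
  -- The overlap `⟨u_x, v_y⟩` is split through `P` and `1 - P`. The first part is charged to `σ`
  -- through `b μ_y`, the second to `ρ` through `λ_x`.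
  set A := Uᴴ * P * V with hA
  set B := Uᴴ * (1 - P) * V with hB
  have hAB : Uᴴ * V = A + B := by
    rw [hA, hB, ← Matrix.add_mul, ← Matrix.mul_add, add_sub_cancel, Matrix.mul_one]
  have hAy : ∀ y, ∑ x, ‖A x y‖ ^ 2 = ((Vᴴ * P * V) y y).re := by
    intro y
    have : Vᴴ * P * V = Aᴴ * A := by
      rw [hA, conjTranspose_mul, conjTranspose_mul, hPs, conjTranspose_conjTranspose]
      calc Vᴴ * P * V = Vᴴ * (P * P) * V := by rw [hPP]
        _ = Vᴴ * (P * (U * Uᴴ) * P) * V := by rw [hU', Matrix.mul_one]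
        _ = _ := by simp only [Matrix.mul_assoc]
    rw [this, Matrix.mul_apply, Complex.re_sum]
    refine Finset.sum_congr rfl fun x _ => ?_
    rw [conjTranspose_apply, Complex.star_def, ← Complex.normSq_eq_conj_mul_self,
      Complex.ofReal_re, Complex.normSq_eq_norm_sq]
  have hBx : ∀ x, ∑ y, ‖B x y‖ ^ 2 = ((Uᴴ * (1 - P) * U) x x).re := by
    intro x
    have : Uᴴ * (1 - P) * U = B * Bᴴ := by
      rw [hB, conjTranspose_mul, conjTranspose_mul, hQs, conjTranspose_conjTranspose]
      calc Uᴴ * (1 - P) * U = Uᴴ * ((1 - P) * (1 - P)) * U := by rw [hQQ]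
        _ = Uᴴ * ((1 - P) * (V * Vᴴ) * (1 - P)) * U := by rw [hV', Matrix.mul_one]
        _ = _ := by simp only [Matrix.mul_assoc]
    rw [this, Matrix.mul_apply, Complex.re_sum]
    refine Finset.sum_congr rfl fun y _ => ?_
    rw [conjTranspose_apply, Complex.star_def, Complex.mul_conj,
      Complex.ofReal_re, Complex.normSq_eq_norm_sq]
  have hpt : ∀ x y, ‖(Uᴴ * V) x y‖ ^ 2 * min (lam x) (b * mu y)
      ≤ (1 + t) * b * (mu y * ‖A x y‖ ^ 2) + (1 + 1 / t) * (lam x * ‖B x y‖ ^ 2) := by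
    intro x y
    have h0 : 0 ≤ min (lam x) (b * mu y) := le_min (hlam x) (mul_nonneg hb (hmu y))
    have h1 : (0 : ℝ) ≤ (1 + t) * ‖A x y‖ ^ 2 := by positivity
    have h2 : (0 : ℝ) ≤ (1 + 1 / t) * ‖B x y‖ ^ 2 := by positivity
    rw [hAB, Matrix.add_apply]
    calc ‖A x y + B x y‖ ^ 2 * min (lam x) (b * mu y)
        ≤ ((1 + t) * ‖A x y‖ ^ 2 + (1 + 1 / t) * ‖B x y‖ ^ 2) * min (lam x) (b * mu y) :=
          mul_le_mul_of_nonneg_right (norm_add_sq_le_weighted _ _ ht) h0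
      _ ≤ (1 + t) * ‖A x y‖ ^ 2 * (b * mu y) + (1 + 1 / t) * ‖B x y‖ ^ 2 * lam x := by
          rw [add_mul]
          exact add_le_add (mul_le_mul_of_nonneg_left (min_le_right _ _) h1)
            (mul_le_mul_of_nonneg_left (min_le_left _ _) h2)
      _ = _ := by ring
  calc ∑ x, ∑ y, ‖(Uᴴ * V) x y‖ ^ 2 * min (lam x) (b * mu y)
      ≤ ∑ x, ∑ y, ((1 + t) * b * (mu y * ‖A x y‖ ^ 2)
          + (1 + 1 / t) * (lam x * ‖B x y‖ ^ 2)) :=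
        Finset.sum_le_sum fun x _ => Finset.sum_le_sum fun y _ => hpt x y
    _ = (1 + t) * b * ∑ y, mu y * ∑ x, ‖A x y‖ ^ 2
          + (1 + 1 / t) * ∑ x, lam x * ∑ y, ‖B x y‖ ^ 2 := by
        simp only [Finset.sum_add_distrib, Finset.mul_sum]
        rw [Finset.sum_comm]
    _ = _ := by
        rw [trace_mul_unitaryDiag_re, trace_mul_unitaryDiag_re]
        simp only [hAy, hBx]

end StrongConverse

/-! ### Measurements made of eigenvectors. -/

section Eigenvalues

open Classical in
/-- If the elements of `M` consist of eigenvectors, an outcome with eigenvalue above `b` is at most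
as likely as the corresponding spectral projection. -/
theorem PVM.sum_prob_eigenvalue_gt_le {Ω d : Type*} [Fintype Ω] [Fintype d] [DecidableEq d]
    (M : PVM Ω d) {V : Matrix d d ℂ} (hV : Vᴴ * V = 1) (hV' : V * Vᴴ = 1) {mu : d → ℝ}
    {ν : Ω → ℝ} (hν : ∀ i, unitaryDiag V mu * M.elem i = (ν i : ℂ) • M.elem i)
    {ρ : Matrix d d ℂ} (hρ : ρ.PosSemidef) (b : ℝ) :
    ∑ i with b < ν i, M.prob ρ i ≤ ∑ y with b < mu y, ((Vᴴ * ρ * V) y y).re := by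
  set p : d → ℝ := fun y => if b < mu y then 1 else 0 with hp
  set Q := unitaryDiag V p with hQ
  -- The range of `M_i` has components only along those `v_y` with `μ_y = ν_i`.
  have hQM : ∀ i, b < ν i → Q * M.elem i = M.elem i := by
    intro i hi
    have h1 : ∀ y z, (mu y : ℂ) * (Vᴴ * M.elem i) y z = ν i * (Vᴴ * M.elem i) y z := by
      intro y z
      have h2 := congrArg (fun X => (Vᴴ * X) y z) (hν i)
      simp only [unitaryDiag] at h2
      rw [show Vᴴ * (V * diagonal (fun i => (mu i : ℂ)) * Vᴴ * M.elem i)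
        = (Vᴴ * V) * (diagonal (fun i => (mu i : ℂ)) * (Vᴴ * M.elem i)) by
          simp only [Matrix.mul_assoc], hV, Matrix.one_mul, diagonal_mul] at h2
      rw [h2, Matrix.mul_smul, Matrix.smul_apply, smul_eq_mul]
    have h3 : diagonal (fun y => (p y : ℂ)) * (Vᴴ * M.elem i) = Vᴴ * M.elem i := by
      ext y z
      rw [diagonal_mul]
      simp only [hp]
      split_ifs with hy
      · simp
      · have hne : (mu y : ℂ) - ν i ≠ 0 := by
          rw [sub_ne_zero]
          intro he
          have he' : mu y = ν i := by exact_mod_cast he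
          exact hy (he' ▸ hi)
        have h4 : ((mu y : ℂ) - ν i) * (Vᴴ * M.elem i) y z = 0 := by
          rw [sub_mul, h1, sub_self]
        rw [(mul_eq_zero.mp h4).resolve_left hne, mul_zero]
    rw [hQ, unitaryDiag, Matrix.mul_assoc, Matrix.mul_assoc, h3, ← Matrix.mul_assoc, hV',
      Matrix.one_mul]
  set S : Finset Ω := Finset.univ.filter fun i => b < ν i with hS
  set P := ∑ i ∈ S, M.elem i with hP
  have hPproj : IsStarProjection P := M.isStarProjection_sum S
  have hPs : Pᴴ = P := hPproj.isSelfAdjoint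
  have hQs : Qᴴ = Q := unitaryDiag_conjTranspose p
  have hQP : Q * P = P := by
    rw [hP, Finset.mul_sum]
    exact Finset.sum_congr rfl fun i hi => hQM i (Finset.mem_filter.mp hi).2
  have hPQ : P * Q = P := by
    have := congrArg conjTranspose hQP
    rwa [conjTranspose_mul, hPs, hQs] at this
  have hQQ : Q * Q = Q := by
    rw [hQ, unitaryDiag_mul hV]
    congr 1
    funext x
    simp only [hp]; split_ifs <;> norm_num
  -- `P` is a subprojection of `Q`, so `Q - P` is again a projection and `Tr P ρ ≤ Tr Q ρ`.
  have hdiff2 : (Q - P) * (Q - P) = Q - P := by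
    rw [Matrix.mul_sub, Matrix.sub_mul, Matrix.sub_mul, hQQ, hPQ, hQP,
      hPproj.isIdempotentElem.eq, sub_self, sub_zero]
  have hdiffs : (Q - P)ᴴ = Q - P := by rw [conjTranspose_sub, hQs, hPs]
  have hdiff : IsStarProjection (Q - P) := ⟨hdiff2, hdiffs⟩
  have hnn := hdiff.matrix_posSemidef.trace_mul_re_nonneg hρ
  rw [Matrix.sub_mul, Matrix.trace_sub, Complex.sub_re] at hnn
  have hQρ : (Q * ρ).trace.re = ∑ y with b < mu y, ((Vᴴ * ρ * V) y y).re := by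
    rw [Matrix.trace_mul_comm, hQ, trace_mul_unitaryDiag_re, Finset.sum_filter]
    refine Finset.sum_congr rfl fun y _ => ?_
    simp only [hp]
    split_ifs <;> simp
  rw [POVM.sum_prob_finset, ← hQρ]
  linarith

end Eigenvalues

/-! ### Weak law of large numbers on finite product spaces. -/

section LawOfLargeNumbers

variable {α : Type*}

theorem log_prod_pi_eq {P g : α → ℝ} (hg : ∀ a, P a ≠ 0 → 0 < g a) {n : ℕ} {x : Fin n → α}
    (hx : ∏ j, P (x j) ≠ 0) :
    0 < ∏ j, g (x j) ∧ Real.log (∏ j, g (x j)) = ∑ j, Real.log (g (x j)) := by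
  have h : ∀ j, 0 < g (x j) := fun j => hg _ (Finset.prod_ne_zero_iff.mp hx j (Finset.mem_univ j))
  exact ⟨Finset.prod_pos fun j _ => h j, Real.log_prod fun j _ => (h j).ne'⟩

variable [Fintype α]

theorem Fin.sum_univ_pi_succ {n : ℕ} (F : (Fin (n + 1) → α) → ℝ) :
    ∑ x, F x = ∑ a, ∑ y : Fin n → α, F (Fin.cons a y) := by
  rw [← Fintype.sum_prod_type']
  exact (Fintype.sum_equiv (Fin.consEquiv fun _ => α) _ _ fun _ => rfl).symm

theorem sum_pi_prod_eq_one {P : α → ℝ} (hP : ∑ a, P a = 1) (n : ℕ) :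
    ∑ x : Fin n → α, ∏ j, P (x j) = 1 := by
  classical
  rw [← Finset.prod_const_one (s := (Finset.univ : Finset (Fin n))), ← hP,
    Finset.prod_univ_sum]
  simp

theorem sum_pi_prod_mul_sum {P g : α → ℝ} (hP : ∑ a, P a = 1) (hg : ∑ a, P a * g a = 0) (n : ℕ) :
    ∑ x : Fin n → α, (∏ j, P (x j)) * ∑ j, g (x j) = 0 := by
  induction n with
  | zero => simp
  | succ n ih =>
    rw [Fin.sum_univ_pi_succ]
    simp only [Fin.prod_univ_succ, Fin.sum_univ_succ, Fin.cons_zero, Fin.cons_succ]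
    have : ∀ a, ∑ y : Fin n → α, (P a * ∏ j, P (y j)) * (g a + ∑ j, g (y j))
        = P a * g a := fun a => by
      have h1 : ∀ y : Fin n → α, (P a * ∏ j, P (y j)) * (g a + ∑ j, g (y j))
          = P a * g a * (∏ j, P (y j)) + P a * ((∏ j, P (y j)) * ∑ j, g (y j)) :=
        fun y => by ring
      simp only [h1, Finset.sum_add_distrib, ← Finset.mul_sum]
      rw [sum_pi_prod_eq_one hP, ih, mul_zero, add_zero, mul_one]
    simp only [this, hg]

/-- Additivity of variance: the cross terms vanish because `g` is centred. -/
theorem sum_pi_prod_mul_sum_sq {P g : α → ℝ} (hP : ∑ a, P a = 1) (hg : ∑ a, P a * g a = 0)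
    (n : ℕ) :
    ∑ x : Fin n → α, (∏ j, P (x j)) * (∑ j, g (x j)) ^ 2 = n * ∑ a, P a * g a ^ 2 := by
  induction n with
  | zero => simp
  | succ n ih =>
    rw [Fin.sum_univ_pi_succ]
    simp only [Fin.prod_univ_succ, Fin.sum_univ_succ, Fin.cons_zero, Fin.cons_succ]
    have : ∀ a, ∑ y : Fin n → α, (P a * ∏ j, P (y j)) * (g a + ∑ j, g (y j)) ^ 2
        = P a * g a ^ 2 + P a * (n * ∑ a, P a * g a ^ 2) := fun a => by
      have h1 : ∀ y : Fin n → α, (P a * ∏ j, P (y j)) * (g a + ∑ j, g (y j)) ^ 2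
          = P a * g a ^ 2 * (∏ j, P (y j))
            + P a * g a * 2 * ((∏ j, P (y j)) * ∑ j, g (y j))
            + P a * ((∏ j, P (y j)) * (∑ j, g (y j)) ^ 2) := fun y => by ring
      simp only [h1, Finset.sum_add_distrib, ← Finset.mul_sum]
      rw [sum_pi_prod_eq_one hP, sum_pi_prod_mul_sum hP hg, ih, mul_zero, add_zero, mul_one]
    simp only [this, Finset.sum_add_distrib, ← Finset.sum_mul, hP]
    push_cast
    ring

open Classical in
/-- The weak law of large numbers for independent copies of a random variable with finitely many
values. -/
theorem tendsto_sum_pi_deviation {P : α → ℝ} (hP0 : ∀ a, 0 ≤ P a) (hP : ∑ a, P a = 1)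
    (f : α → ℝ) {ε : ℝ} (hε : 0 < ε) :
    Tendsto (fun n : ℕ => ∑ x : Fin n → α with n * ε ≤ |∑ j, f (x j) - n * ∑ a, P a * f a|,
      ∏ j, P (x j)) atTop (𝓝 0) := by
  set m := ∑ a, P a * f a with hm
  set g : α → ℝ := fun a => f a - m with hgdef
  have hg : ∑ a, P a * g a = 0 := by
    simp only [hgdef, mul_sub, Finset.sum_sub_distrib, ← Finset.sum_mul, hP, hm]
    ring
  set v := ∑ a, P a * g a ^ 2 with hv
  have hlim : Tendsto (fun n : ℕ => v / ε ^ 2 / n) atTop (𝓝 0) :=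
    tendsto_const_div_atTop_nhds_zero_nat _
  refine squeeze_zero' (Eventually.of_forall fun n => Finset.sum_nonneg fun x _ =>
    Finset.prod_nonneg fun j _ => hP0 _) ?_ hlim
  filter_upwards [eventually_gt_atTop 0] with n hn
  have hn' : (0 : ℝ) < n := by exact_mod_cast hn
  rw [div_div, le_div_iff₀ (by positivity)]
  have h1 : ∀ x : Fin n → α, ∑ j, f (x j) - n * m = ∑ j, g (x j) := fun x => by
    simp only [hgdef, Finset.sum_sub_distrib, Finset.sum_const, Finset.card_univ,
      Fintype.card_fin, nsmul_eq_mul]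
  simp only [h1]
  have h2 : (∑ x : Fin n → α with n * ε ≤ |∑ j, g (x j)|, ∏ j, P (x j)) * (n * ε) ^ 2
      ≤ n * v := by
    rw [← sum_pi_prod_mul_sum_sq hP hg n, Finset.sum_mul]
    calc _ ≤ ∑ x : Fin n → α with n * ε ≤ |∑ j, g (x j)|,
          (∏ j, P (x j)) * (∑ j, g (x j)) ^ 2 := by
          refine Finset.sum_le_sum fun x hx => mul_le_mul_of_nonneg_left ?_
            (Finset.prod_nonneg fun j _ => hP0 _)
          rw [← sq_abs (∑ j, g (x j))]
          exact pow_le_pow_left₀ (by positivity) (Finset.mem_filter.mp hx).2 2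
      _ ≤ _ := Finset.sum_le_sum_of_subset_of_nonneg (Finset.filter_subset _ _) fun x _ _ =>
          mul_nonneg (Finset.prod_nonneg fun j _ => hP0 _) (sq_nonneg _)
  have h3 : n * ((∑ x : Fin n → α with n * ε ≤ |∑ j, g (x j)|, ∏ j, P (x j)) * (ε ^ 2 * n))
      ≤ n * v := by
    refine le_trans (le_of_eq ?_) h2
    ring
  exact le_of_mul_le_mul_left h3 hn'

open Classical in
-- Taking logarithms turns the product into a sum. Sequences of probability zero are discarded
-- beforehand, so `g` may vanish off the support of `P`; this allows singular `ρ`.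
theorem tendsto_sum_pi_prod_lt {P : α → ℝ} (hP0 : ∀ a, 0 ≤ P a) (hP : ∑ a, P a = 1)
    {g : α → ℝ} (hg : ∀ a, P a ≠ 0 → 0 < g a) {ε : ℝ} (hε : 0 < ε) :
    Tendsto (fun n : ℕ => ∑ x : Fin n → α with
      ∏ j, g (x j) < Real.exp (n * (∑ a, P a * Real.log (g a) - ε)), ∏ j, P (x j))
      atTop (𝓝 0) := by
  refine squeeze_zero (fun n => Finset.sum_nonneg fun x _ => Finset.prod_nonneg fun j _ => hP0 _)
    (fun n => ?_) (tendsto_sum_pi_deviation hP0 hP (fun a => Real.log (g a)) hε)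
  rw [← Finset.sum_filter_ne_zero]
  refine Finset.sum_le_sum_of_subset_of_nonneg (fun x hx => ?_) fun x _ _ =>
    Finset.prod_nonneg fun j _ => hP0 _
  rw [Finset.mem_filter, Finset.mem_filter] at hx
  obtain ⟨h0, h1⟩ := log_prod_pi_eq hg hx.2
  refine Finset.mem_filter.mpr ⟨Finset.mem_univ _, ?_⟩
  have h2 := (Real.log_lt_iff_lt_exp h0).mpr hx.1.2
  rw [h1] at h2
  rw [le_abs]
  right
  linarith

open Classical in
theorem tendsto_sum_pi_prod_gt {P : α → ℝ} (hP0 : ∀ a, 0 ≤ P a) (hP : ∑ a, P a = 1)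
    {g : α → ℝ} (hg : ∀ a, P a ≠ 0 → 0 < g a) {ε : ℝ} (hε : 0 < ε) :
    Tendsto (fun n : ℕ => ∑ x : Fin n → α with
      Real.exp (n * (∑ a, P a * Real.log (g a) + ε)) < ∏ j, g (x j), ∏ j, P (x j))
      atTop (𝓝 0) := by
  refine squeeze_zero (fun n => Finset.sum_nonneg fun x _ => Finset.prod_nonneg fun j _ => hP0 _)
    (fun n => ?_) (tendsto_sum_pi_deviation hP0 hP (fun a => Real.log (g a)) hε)
  rw [← Finset.sum_filter_ne_zero]
  refine Finset.sum_le_sum_of_subset_of_nonneg (fun x hx => ?_) fun x _ _ =>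
    Finset.prod_nonneg fun j _ => hP0 _
  rw [Finset.mem_filter, Finset.mem_filter] at hx
  obtain ⟨h0, h1⟩ := log_prod_pi_eq hg hx.2
  refine Finset.mem_filter.mpr ⟨Finset.mem_univ _, ?_⟩
  have h2 := (Real.lt_log_iff_exp_lt h0).mpr hx.1.2
  rw [h1] at h2
  rw [le_abs]
  left
  linarith

end LawOfLargeNumbers

/-! ### Tensor powers and their spectral decomposition. -/

section TensorPower

variable {ι : Type*}

theorem tensorPow_apply (A : Matrix ι ι ℂ) (n : ℕ) (x y : Fin n → ι) :
    tensorPow A n x y = ∏ j, A (x j) (y j) := rfl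

theorem tensorPow_conjTranspose (A : Matrix ι ι ℂ) (n : ℕ) :
    tensorPow Aᴴ n = (tensorPow A n)ᴴ := by
  ext x y
  simp [tensorPow_apply]

theorem tensorPow_diagonal [DecidableEq ι] (f : ι → ℂ) (n : ℕ) :
    tensorPow (diagonal f) n = diagonal fun x => ∏ j, f (x j) := by
  ext x y
  rw [tensorPow_apply]
  by_cases h : x = y
  · subst h; simp
  · obtain ⟨j, hj⟩ := Function.ne_iff.mp h
    rw [diagonal_apply_ne _ h]
    exact Finset.prod_eq_zero (Finset.mem_univ j) (diagonal_apply_ne _ hj)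

theorem tensorPow_one [DecidableEq ι] (n : ℕ) : tensorPow (1 : Matrix ι ι ℂ) n = 1 := by
  rw [← diagonal_one, tensorPow_diagonal]
  simp

variable [Fintype ι]

theorem tensorPow_mul (A B : Matrix ι ι ℂ) (n : ℕ) :
    tensorPow (A * B) n = tensorPow A n * tensorPow B n := by
  ext x y
  simp only [tensorPow_apply, Matrix.mul_apply]
  rw [Finset.prod_univ_sum]
  simp [Finset.prod_mul_distrib]

variable [DecidableEq ι]

theorem tensorPow_unitaryDiag (U : Matrix ι ι ℂ) (f : ι → ℝ) (n : ℕ) :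
    tensorPow (unitaryDiag U f) n = unitaryDiag (tensorPow U n) fun x => ∏ j, f (x j) := by
  simp only [unitaryDiag, tensorPow_mul, tensorPow_diagonal, tensorPow_conjTranspose]
  simp

theorem tensorPow_isometry {U : Matrix ι ι ℂ} (hU : Uᴴ * U = 1) (n : ℕ) :
    (tensorPow U n)ᴴ * tensorPow U n = 1 := by
  rw [← tensorPow_conjTranspose, ← tensorPow_mul, hU, tensorPow_one]

theorem tensorPow_coisometry {U : Matrix ι ι ℂ} (hU : U * Uᴴ = 1) (n : ℕ) :
    tensorPow U n * (tensorPow U n)ᴴ = 1 := by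
  rw [← tensorPow_conjTranspose, ← tensorPow_mul, hU, tensorPow_one]

end TensorPower

/-! ### Diagonalization of states. -/

section Diagonalization

variable {d : Type*} [Fintype d] [DecidableEq d]

theorem Matrix.IsHermitian.exists_unitaryDiag {A : Matrix d d ℂ} (hA : A.IsHermitian) :
    ∃ U : Matrix d d ℂ, Uᴴ * U = 1 ∧ U * Uᴴ = 1 ∧ A = unitaryDiag U hA.eigenvalues ∧
      ∀ f : ℝ → ℝ, cfc f A = unitaryDiag U fun x => f (hA.eigenvalues x) := by
  refine ⟨hA.eigenvectorUnitary, ?_, ?_, ?_, fun f => ?_⟩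
  · exact Unitary.coe_star_mul_self _
  · exact Unitary.coe_mul_star_self _
  · conv_lhs => rw [hA.spectral_theorem]
    rfl
  · rw [hA.cfc_eq]
    rfl

theorem IsDensity.exists_unitaryDiag {ρ : Matrix d d ℂ} (hρ : IsDensity ρ) :
    ∃ (U : Matrix d d ℂ) (lam : d → ℝ), Uᴴ * U = 1 ∧ U * Uᴴ = 1 ∧ (∀ x, 0 ≤ lam x) ∧
      ∑ x, lam x = 1 ∧ ρ = unitaryDiag U lam ∧
      ∀ f : ℝ → ℝ, cfc f ρ = unitaryDiag U fun x => f (lam x) := by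
  obtain ⟨U, hU, hU', hρU, hf⟩ := hρ.1.isHermitian.exists_unitaryDiag
  refine ⟨U, _, hU, hU', hρ.1.eigenvalues_nonneg, ?_, hρU, hf⟩
  rw [← unitaryDiag_trace_re hU, ← hρU, hρ.2, Complex.one_re]

/-- For a zero eigenvalue, the projection onto its eigenvector would be annihilated by an invertible
matrix although it has trace one. -/
theorem unitaryDiag_ne_zero_of_isUnit {V : Matrix d d ℂ} (hV : Vᴴ * V = 1)
    {mu : d → ℝ} (h : IsUnit (unitaryDiag V mu)) (y : d) : mu y ≠ 0 := by
  intro hy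
  obtain ⟨u, hu⟩ := h
  have h1 : unitaryDiag V mu * unitaryDiag V (Pi.single y 1) = 0 := by
    rw [unitaryDiag_mul hV]
    have : (fun x => mu x * (Pi.single y 1 : d → ℝ) x) = 0 := by
      funext x
      by_cases hx : x = y
      · subst hx; simp [hy]
      · simp [hx]
    rw [this]
    simp [unitaryDiag]
  rw [← hu] at h1
  have h2 : unitaryDiag V (Pi.single y 1) = 0 := by
    simpa using congrArg (fun X => (↑u⁻¹ : Matrix d d ℂ) * X) h1
  have h3 := unitaryDiag_trace_re hV (Pi.single y 1)
  rw [h2] at h3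
  simp at h3

end Diagonalization

/-! ### Elementary probability for measurement outcomes. -/

namespace POVM

variable {Ω d : Type*} [Fintype Ω] [Fintype d] [DecidableEq d]

theorem probOf_nonneg (M : POVM Ω d) {ρ : Matrix d d ℂ} (hρ : ρ.PosSemidef) (S : Set Ω) :
    0 ≤ M.probOf ρ S :=
  Finset.sum_nonneg fun i _ => M.prob_nonneg hρ i

theorem probOf_mono (M : POVM Ω d) {ρ : Matrix d d ℂ} (hρ : ρ.PosSemidef) {S S' : Set Ω}
    (h : ∀ i, M.prob ρ i ≠ 0 → i ∈ S → i ∈ S') : M.probOf ρ S ≤ M.probOf ρ S' := by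
  classical
  rw [probOf, probOf, ← Finset.sum_filter_ne_zero]
  refine Finset.sum_le_sum_of_subset_of_nonneg (fun i hi => ?_) fun i _ _ => M.prob_nonneg hρ i
  simp only [Finset.mem_filter, Finset.mem_univ, true_and] at hi ⊢
  exact h i hi.2 hi.1

theorem probOf_union_le (M : POVM Ω d) {ρ : Matrix d d ℂ} (hρ : ρ.PosSemidef) (S S' : Set Ω) :
    M.probOf ρ (S ∪ S') ≤ M.probOf ρ S + M.probOf ρ S' := by
  classical
  simp only [probOf, Finset.sum_filter, ← Finset.sum_add_distrib]
  refine Finset.sum_le_sum fun i _ => ?_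
  have := M.prob_nonneg hρ i
  by_cases h1 : i ∈ S <;> by_cases h2 : i ∈ S' <;> simp [h1, h2, this]

theorem probOf_add_compl (M : POVM Ω d) (ρ : Matrix d d ℂ) (S : Set Ω) :
    M.probOf ρ S + M.probOf ρ Sᶜ = ρ.trace.re := by
  classical
  rw [← M.sum_prob ρ, probOf, probOf,
    ← Finset.sum_filter_add_sum_filter_not Finset.univ (fun i => i ∈ S) (M.prob ρ)]
  congr

theorem probOf_setOf (M : POVM Ω d) (ρ : Matrix d d ℂ) (p : Ω → Prop) [DecidablePred p] :
    M.probOf ρ {i | p i} = ∑ i with p i, M.prob ρ i := by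
  rw [probOf]
  congr

/-- Markov's inequality. -/
theorem mul_probOf_le_expect (M : POVM Ω d) {ρ : Matrix d d ℂ} (hρ : ρ.PosSemidef) {f : Ω → ℝ}
    (hf : ∀ i, 0 ≤ f i) (c : ℝ) : c * M.probOf ρ {i | c ≤ f i} ≤ M.expect ρ f := by
  classical
  rw [probOf, Finset.mul_sum, expect]
  refine le_trans (Finset.sum_le_sum fun i hi => ?_)
    (Finset.sum_le_sum_of_subset_of_nonneg (Finset.filter_subset _ _) fun i _ _ =>
      mul_nonneg (hf i) (M.prob_nonneg hρ i))
  exact mul_le_mul_of_nonneg_right (Finset.mem_filter.mp hi).2 (M.prob_nonneg hρ i)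

end POVM

section TensorPowerDensity

variable {ι : Type*} [Fintype ι] [DecidableEq ι]

theorem IsDensity.tensorPow {ρ : Matrix ι ι ℂ} (hρ : IsDensity ρ) (n : ℕ) :
    IsDensity (tensorPow ρ n) := by
  obtain ⟨U, lam, hU, -, hlam, hsum, rfl, -⟩ := hρ.exists_unitaryDiag
  rw [tensorPow_unitaryDiag]
  have hp : (unitaryDiag (_root_.tensorPow U n) fun x => ∏ j, lam (x j)).PosSemidef :=
    unitaryDiag_posSemidef fun x => Finset.prod_nonneg fun j _ => hlam _
  refine ⟨hp, Complex.ext ?_ ?_⟩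
  · rw [unitaryDiag_trace_re (tensorPow_isometry hU n), sum_pi_prod_eq_one hsum, Complex.one_re]
  · exact (Complex.le_def.mp hp.trace_nonneg).2.symm

end TensorPowerDensity

/-! ### Exponential decay beats polynomial growth. -/

section Asymptotics

theorem tendsto_polynomial_mul_exp_neg (m : ℕ) {c : ℝ} (hc : 0 < c) :
    Tendsto (fun n : ℕ => ((n : ℝ) + 1) ^ m * Real.exp (-(n * c))) atTop (𝓝 0) := by
  have hr : |Real.exp (-c)| < 1 := by
    rw [abs_of_pos (Real.exp_pos _), Real.exp_lt_one_iff]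
    linarith
  have h := ((tendsto_add_atTop_iff_nat 1).mpr
    (tendsto_pow_const_mul_const_pow_of_abs_lt_one m hr)).mul_const (Real.exp c)
  rw [zero_mul] at h
  refine h.congr fun n => ?_
  rw [mul_assoc, ← Real.exp_nat_mul, ← Real.exp_add]
  push_cast
  congr 2
  ring

theorem tendsto_exp_neg_mul {c : ℝ} (hc : 0 < c) :
    Tendsto (fun n : ℕ => Real.exp (-(n * c))) atTop (𝓝 0) := by
  simpa using tendsto_polynomial_mul_exp_neg 0 hc

end Asymptotics

/-! ### Asymptotics of outcome probabilities and the strong converse. -/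

section Concentration

variable {ι : Type*} [Fintype ι] [DecidableEq ι] {ρ σ : Matrix ι ι ℂ}

/-- For refinements of `E^n` the outcome probabilities in the state `ρ^{⊗ n}` are not much smaller
than `exp (n Tr ρ log ρ)`. -/
theorem tendsto_probOf_prob_le (hρ : IsDensity ρ) {I Ω : ℕ → Type*} [∀ n, Fintype (I n)]
    [∀ n, Fintype (Ω n)] {E : ∀ n, PVM (I n) (Fin n → ι)} {M : ∀ n, PVM (Ω n) (Fin n → ι)}
    (hEρ : ∀ n, (E n).CommutesWith (tensorPow ρ n)) {m : ℕ} (hEw : ∀ n, (E n).w ≤ (n + 1) ^ m)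
    (h : ∀ n, (E n).RefinedBy (M n)) {ε : ℝ} (hε : 0 < ε) :
    Tendsto (fun n : ℕ => (M n).probOf (tensorPow ρ n) {i | (M n).prob (tensorPow ρ n) i
      ≤ Real.exp (n * ((ρ * cfc Real.log ρ).trace.re - ε))}) atTop (𝓝 0) := by
  classical
  have hnn : ∀ n S, 0 ≤ (M n).probOf (tensorPow ρ n) S := fun n S =>
    (M n).probOf_nonneg (hρ.tensorPow n).1 S
  obtain ⟨U, lam, hU, hU', hlam, hsum, rfl, hcfc⟩ := hρ.exists_unitaryDiag
  rw [hcfc, unitaryDiag_mul hU, unitaryDiag_trace_re hU]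
  -- The eigenvalue threshold `L` is taken at `ε / 2` and the probability threshold `τ` at `ε`, so
  -- `τ / L = exp (-n ε / 2)` absorbs the polynomial `w(E^n)`.
  have hlln := (tendsto_sum_pi_prod_lt hlam hsum (g := lam)
    (fun a ha => lt_of_le_of_ne (hlam a) ha.symm) (half_pos hε)).add
    (tendsto_polynomial_mul_exp_neg m (half_pos hε))
  rw [add_zero] at hlln
  refine squeeze_zero (fun n => hnn n _) (fun n => ?_) hlln
  rw [POVM.probOf_setOf]
  have hE := hEρ n
  simp only [tensorPow_unitaryDiag] at hE ⊢
  refine le_trans (le_of_eq ?_) ((PVM.sum_small_prob_le (h n) (tensorPow_isometry hU n)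
    (tensorPow_coisometry hU' n) (fun x => Finset.prod_nonneg fun j _ => hlam _)
    (sum_pi_prod_eq_one hsum n) hE
    (Real.exp_pos (n * (∑ a, lam a * Real.log (lam a) - ε / 2)))
    (Real.exp_pos (n * (∑ a, lam a * Real.log (lam a) - ε))).le).trans
    (add_le_add (le_of_eq ?_) ?_))
  · congr
  · congr
  · rw [mul_div_assoc, ← Real.exp_sub]
    refine mul_le_mul (by exact_mod_cast hEw n) (le_of_eq ?_) (Real.exp_pos _).le (by positivity)
    congr 1
    ring

/-- For measurements with elements of rank at most one the outcome probabilities in the state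
`ρ^{⊗ n}` are not much larger than `exp (n Tr ρ log ρ)`. -/
theorem tendsto_probOf_le_prob (hρ : IsDensity ρ) {Ω : ℕ → Type*}
    [∀ n, Fintype (Ω n)] {M : ∀ n, POVM (Ω n) (Fin n → ι)}
    (hM : ∀ n i, ((M n).elem i).trace.re ≤ 1) {ε : ℝ} (hε : 0 < ε) :
    Tendsto (fun n : ℕ => (M n).probOf (tensorPow ρ n)
      {i | Real.exp (n * ((ρ * cfc Real.log ρ).trace.re + ε)) ≤ (M n).prob (tensorPow ρ n) i})
      atTop (𝓝 0) := by
  classical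
  have hnn : ∀ n S, 0 ≤ (M n).probOf (tensorPow ρ n) S := fun n S =>
    (M n).probOf_nonneg (hρ.tensorPow n).1 S
  obtain ⟨U, lam, hU, hU', hlam, hsum, rfl, hcfc⟩ := hρ.exists_unitaryDiag
  rw [hcfc, unitaryDiag_mul hU, unitaryDiag_trace_re hU]
  have hlln := (tendsto_sum_pi_prod_gt hlam hsum (g := lam)
    (fun a ha => lt_of_le_of_ne (hlam a) ha.symm) (half_pos hε)).add
    (tendsto_exp_neg_mul (half_pos hε))
  rw [add_zero] at hlln
  refine squeeze_zero (fun n => hnn n _) (fun n => ?_) hlln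
  rw [POVM.probOf_setOf]
  simp only [tensorPow_unitaryDiag]
  refine le_trans (le_of_eq ?_) (((M n).sum_large_prob_le (hM n) (tensorPow_isometry hU n)
    (tensorPow_coisometry hU' n) (fun x => Finset.prod_nonneg fun j _ => hlam _)
    (sum_pi_prod_eq_one hsum n)
    (Real.exp_pos (n * (∑ a, lam a * Real.log (lam a) + ε / 2))).le
    (Real.exp_pos (n * (∑ a, lam a * Real.log (lam a) + ε)))).trans
    (add_le_add (le_of_eq ?_) (le_of_eq ?_)))
  · congr
  · congr
  · rw [← Real.exp_sub]
    congr 1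
    ring

/-- The matrix `Uᴴ V` has orthonormal rows. -/
theorem sum_norm_sq_row {U V : Matrix ι ι ℂ} (hU : Uᴴ * U = 1) (hV : V * Vᴴ = 1) (a : ι) : ∑ b, ‖(Uᴴ * V) a b‖ ^ 2 = 1 := by
  have h : (Uᴴ * V) * (Uᴴ * V)ᴴ = 1 := by
    rw [conjTranspose_mul, conjTranspose_conjTranspose, Matrix.mul_assoc, ← Matrix.mul_assoc V,
      hV, Matrix.one_mul, hU]
  have h1 := congrArg (fun X : Matrix ι ι ℂ => (X a a).re) h
  simp only [Matrix.mul_apply, Complex.re_sum, conjTranspose_apply, Complex.star_def,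
    Complex.mul_conj, Complex.ofReal_re, Complex.normSq_eq_norm_sq, one_apply_eq,
    Complex.one_re] at h1
  simpa only [Matrix.mul_apply, conjTranspose_apply, Complex.star_def] using h1

theorem conj_unitaryDiag_diag_re {U V : Matrix ι ι ℂ} (lam : ι → ℝ) (b : ι) :
    ((Vᴴ * unitaryDiag U lam * V) b b).re = ∑ a, lam a * ‖(Uᴴ * V) a b‖ ^ 2 := by
  have h : Vᴴ * unitaryDiag U lam * V
      = (Uᴴ * V)ᴴ * (diagonal (fun i => (lam i : ℂ)) * (Uᴴ * V)) := by
    rw [conjTranspose_mul, conjTranspose_conjTranspose]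
    simp only [unitaryDiag, Matrix.mul_assoc]
  rw [h, Matrix.mul_apply, Complex.re_sum]
  refine Finset.sum_congr rfl fun a _ => ?_
  rw [diagonal_mul, conjTranspose_apply, Complex.star_def, mul_left_comm,
    ← Complex.normSq_eq_conj_mul_self, ← Complex.ofReal_mul, Complex.ofReal_re,
    Complex.normSq_eq_norm_sq]

/-- The strong converse part of the quantum Stein lemma for projective tests. -/
theorem tendsto_trace_of_trace_le_exp (hρ : IsDensity ρ) (hσ : IsDensity σ) (hσ_inv : IsUnit σ)
    {P : ∀ n : ℕ, Matrix (Fin n → ι) (Fin n → ι) ℂ} (hP : ∀ n, IsStarProjection (P n))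
    {ε : ℝ} (hε : 0 < ε)
    (hPσ : ∀ᶠ n : ℕ in atTop, (P n * tensorPow σ n).trace.re
      ≤ Real.exp (-(n * (quantumRelEntropy ρ σ + ε)))) :
    Tendsto (fun n : ℕ => (P n * tensorPow ρ n).trace.re) atTop (𝓝 0) := by
  classical
  have hnn : ∀ n, 0 ≤ (P n * tensorPow ρ n).trace.re := fun n =>
    (hP n).matrix_posSemidef.trace_mul_re_nonneg (hρ.tensorPow n).1
  have htr : ∀ n, (tensorPow ρ n).trace.re = 1 := fun n => by
    rw [(hρ.tensorPow n).2, Complex.one_re]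
  obtain ⟨U, lam, hU, hU', hlam, hsum, rfl, hcfc⟩ := hρ.exists_unitaryDiag
  obtain ⟨V, mu, hV, hV', hmu0, -, rfl, hcfc'⟩ := hσ.exists_unitaryDiag
  have hmu : ∀ y, 0 < mu y := fun y =>
    lt_of_le_of_ne (hmu0 y) (unitaryDiag_ne_zero_of_isUnit hV hσ_inv y).symm
  set W := Uᴴ * V with hW
  -- The Nussbaum–Szkoła distribution on pairs of eigenvectors; the mean of `log (λ_a / μ_b)` under
  -- it is `D`.
  set p : ι × ι → ℝ := fun z => lam z.1 * ‖W z.1 z.2‖ ^ 2 with hp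
  have hp0 : ∀ z, 0 ≤ p z := fun z => mul_nonneg (hlam _) (sq_nonneg _)
  have hWsum : ∀ a, ∑ b, ‖W a b‖ ^ 2 = 1 := sum_norm_sq_row hU hV'
  have hp1 : ∑ z, p z = 1 := by
    rw [Fintype.sum_prod_type]
    simp only [hp, ← Finset.mul_sum, hWsum, mul_one, hsum]
  set g : ι × ι → ℝ := fun z => lam z.1 / mu z.2 with hg
  have hg0 : ∀ z, p z ≠ 0 → 0 < g z := fun z hz =>
    div_pos (lt_of_le_of_ne (hlam _) (left_ne_zero_of_mul hz).symm) (hmu _)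
  have hD : quantumRelEntropy (unitaryDiag U lam) (unitaryDiag V mu)
      = ∑ z, p z * Real.log (g z) := by
    rw [quantumRelEntropy, Matrix.mul_sub, Matrix.trace_sub, Complex.sub_re, hcfc, hcfc',
      unitaryDiag_mul hU, unitaryDiag_trace_re hU, trace_mul_unitaryDiag_re]
    -- For `λ_a = 0` the weight vanishes, which matches the convention `0 log 0 = 0`.
    have hlog : ∀ z, p z * Real.log (g z)
        = p z * Real.log (lam z.1) - p z * Real.log (mu z.2) := fun z => by
      by_cases hz : lam z.1 = 0
      · simp [hp, hz]
      · rw [hg, Real.log_div hz (hmu _).ne', mul_sub]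
    simp only [hlog, Finset.sum_sub_distrib]
    congr 1
    · rw [Fintype.sum_prod_type]
      refine Finset.sum_congr rfl fun a _ => ?_
      simp only [hp]
      rw [← Finset.sum_mul, ← Finset.mul_sum, hWsum, mul_one]
    · rw [Fintype.sum_prod_type, Finset.sum_comm]
      refine Finset.sum_congr rfl fun b _ => ?_
      rw [conj_unitaryDiag_diag_re, mul_comm, Finset.sum_mul]
  rw [hD] at hPσ
  set D := ∑ z, p z * Real.log (g z) with hDdef
  set δ : ℕ → ℝ := fun n => ∑ z : Fin n → ι × ι with
      Real.exp (n * (D + ε / 2)) < ∏ j, g (z j), ∏ j, p (z j) with hδ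
  have hδlim : Tendsto δ atTop (𝓝 0) := tendsto_sum_pi_prod_gt hp0 hp1 hg0 (half_pos hε)
  -- the Nussbaum–Szkoła bound for the `n`-th tensor power
  have hNS : ∀ n, 1 - δ n ≤ ∑ x, ∑ y, ‖((tensorPow U n)ᴴ * tensorPow V n) x y‖ ^ 2
      * min (∏ j, lam (x j)) (Real.exp (n * (D + ε / 2)) * ∏ j, mu (y j)) := by
    intro n
    rw [← Fintype.sum_prod_type']
    -- Pairs of sequences are read as sequences of pairs, so that the product distribution of `p`
    -- appears.
    rw [← Fintype.sum_equiv (Equiv.arrowProdEquivProdArrow (Fin n) (fun _ => ι) (fun _ => ι))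
      (fun z => ‖((tensorPow U n)ᴴ * tensorPow V n) (fun j => (z j).1) (fun j => (z j).2)‖ ^ 2
        * min (∏ j, lam (z j).1) (Real.exp (n * (D + ε / 2)) * ∏ j, mu (z j).2)) _
      (fun z => rfl)]
    rw [← sum_pi_prod_eq_one hp1 n, hδ, sub_le_iff_le_add,
      ← Finset.sum_filter_not_add_sum_filter _
        (fun z : Fin n → ι × ι => Real.exp (n * (D + ε / 2)) < ∏ j, g (z j))]
    refine add_le_add ?_ le_rfl
    refine le_trans (Finset.sum_le_sum fun z hz => ?_)
      (Finset.sum_le_sum_of_subset_of_nonneg (Finset.filter_subset _ _) fun z _ _ =>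
        mul_nonneg (sq_nonneg _) (le_min (Finset.prod_nonneg fun j _ => hlam _)
          (mul_nonneg (Real.exp_pos _).le (Finset.prod_nonneg fun j _ => hmu0 _))))
    -- Off the atypical event the likelihood ratio is at most `exp (n (D + ε / 2))`, so the minimum
    -- is the `ρ`-eigenvalue.
    have hz' := not_lt.mp (Finset.mem_filter.mp hz).2
    simp only [hg, Finset.prod_div_distrib] at hz'
    rw [div_le_iff₀ (Finset.prod_pos fun j _ => hmu _)] at hz'
    rw [min_eq_left hz', ← tensorPow_conjTranspose, ← tensorPow_mul, tensorPow_apply, norm_prod,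
      ← Finset.prod_pow, mul_comm, ← Finset.prod_mul_distrib]
  have hbound : ∀ t : ℝ, 0 < t → ∀ᶠ n : ℕ in atTop,
      (P n * tensorPow (unitaryDiag U lam) n).trace.re
        ≤ 1 / t + (δ n + (1 + t) * Real.exp (-(n * (ε / 2)))) := by
    intro t ht
    filter_upwards [hPσ] with n hn
    have h1 := (hNS n).trans (sum_overlap_min_le (tensorPow_coisometry hU' n)
      (tensorPow_coisometry hV' n) (fun x => Finset.prod_nonneg fun j _ => hlam _)
      (fun x => Finset.prod_nonneg fun j _ => hmu0 _) (hP n)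
      (Real.exp_pos (n * (D + ε / 2))).le ht)
    rw [← tensorPow_unitaryDiag, ← tensorPow_unitaryDiag, Matrix.sub_mul, Matrix.one_mul,
      Matrix.trace_sub, Complex.sub_re, htr] at h1
    have h2 : (1 + t) * Real.exp (n * (D + ε / 2))
        * (P n * tensorPow (unitaryDiag V mu) n).trace.re
        ≤ (1 + t) * Real.exp (-(n * (ε / 2))) := by
      calc _ ≤ (1 + t) * Real.exp (n * (D + ε / 2)) * Real.exp (-(n * (D + ε))) :=
            mul_le_mul_of_nonneg_left hn (by positivity)
        _ = _ := by
            rw [mul_assoc, ← Real.exp_add]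
            congr 2
            ring
    have h3 : 0 ≤ 1 / t * (P n * tensorPow (unitaryDiag U lam) n).trace.re :=
      mul_nonneg (by positivity) (hnn n)
    have h4 : (1 + 1 / t) * (1 - (P n * tensorPow (unitaryDiag U lam) n).trace.re)
        = 1 + 1 / t - (P n * tensorPow (unitaryDiag U lam) n).trace.re
          - 1 / t * (P n * tensorPow (unitaryDiag U lam) n).trace.re := by ring
    linarith
  rw [Metric.tendsto_atTop']
  have key : ∀ η : ℝ, 0 < η → ∀ᶠ n : ℕ in atTop,
      (P n * tensorPow (unitaryDiag U lam) n).trace.re < η := by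
    intro η hη
    -- This weight makes the term `1 / t` equal to `η / 2`.
    have ht : 0 < 2 / η := by positivity
    have hlim : Tendsto (fun n : ℕ => δ n + (1 + 2 / η) * Real.exp (-(n * (ε / 2)))) atTop
        (𝓝 0) := by
      simpa using hδlim.add ((tendsto_exp_neg_mul (half_pos hε)).const_mul (1 + 2 / η))
    filter_upwards [hbound _ ht, hlim.eventually_lt_const (half_pos hη)] with n h1 h2
    rw [one_div_div] at h1
    linarith
  intro η hη
  obtain ⟨N, hN⟩ := eventually_atTop.mp (key η hη)
  refine ⟨N, fun n hn => ?_⟩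
  rw [Real.dist_eq, sub_zero, abs_of_nonneg (hnn n)]
  exact hN n hn.le

/-- If the `M_i^n` are made of eigenvectors of `σ^{⊗ n}`, then in the state `ρ^{⊗ n}` the
eigenvalues seen are not much larger than `exp (n Tr ρ log σ)`. -/
theorem tendsto_probOf_eigenvalue_gt (hρ : IsDensity ρ) (hσ : IsDensity σ) (hσ_inv : IsUnit σ)
    {Ω : ℕ → Type*} [∀ n, Fintype (Ω n)] {M : ∀ n, PVM (Ω n) (Fin n → ι)}
    {ν : ∀ n, Ω n → ℝ}
    (hν : ∀ n i, tensorPow σ n * (M n).elem i = (ν n i : ℂ) • (M n).elem i)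
    {ε : ℝ} (hε : 0 < ε) :
    Tendsto (fun n : ℕ => (M n).probOf (tensorPow ρ n)
      {i | Real.exp (n * ((ρ * cfc Real.log σ).trace.re + ε)) < ν n i}) atTop (𝓝 0) := by
  classical
  have hnn : ∀ n S, 0 ≤ (M n).probOf (tensorPow ρ n) S := fun n S =>
    (M n).probOf_nonneg (hρ.tensorPow n).1 S
  obtain ⟨V, mu, hV, hV', hmu0, -, rfl, hcfc'⟩ := hσ.exists_unitaryDiag
  have hmu : ∀ y, 0 < mu y := fun y =>
    lt_of_le_of_ne (hmu0 y) (unitaryDiag_ne_zero_of_isUnit hV hσ_inv y).symm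
  obtain ⟨U, lam, hU, hU', hlam, hsum, rfl, -⟩ := hρ.exists_unitaryDiag
  rw [hcfc', trace_mul_unitaryDiag_re]
  set r : ι → ℝ := fun y => ((Vᴴ * unitaryDiag U lam * V) y y).re with hr
  have hr0 : ∀ y, 0 ≤ r y := fun y => conj_diag_re_nonneg hρ.1 y
  have hr1 : ∑ y, r y = 1 := by
    simp only [hr]
    rw [← Complex.re_sum]
    change (Vᴴ * unitaryDiag U lam * V).trace.re = 1
    rw [Matrix.trace_mul_comm, ← Matrix.mul_assoc, hV', Matrix.one_mul, hρ.2, Complex.one_re]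
  have hlln := tendsto_sum_pi_prod_gt hr0 hr1 (g := mu) (fun y _ => hmu y) hε
  refine squeeze_zero (fun n => hnn n _) (fun n => ?_) hlln
  rw [POVM.probOf_setOf]
  have hν' := hν n
  simp only [tensorPow_unitaryDiag _ mu] at hν'
  have hs : ∑ y, Real.log (mu y) * r y = ∑ y, r y * Real.log (mu y) :=
    Finset.sum_congr rfl fun y _ => mul_comm _ _
  refine le_trans (le_of_eq ?_) (((M n).sum_prob_eigenvalue_gt_le (tensorPow_isometry hV n)
    (tensorPow_coisometry hV' n) hν' (hρ.tensorPow n).1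
    (Real.exp (n * (∑ y, r y * Real.log (mu y) + ε)))).trans (le_of_eq ?_))
  · rw [← hs]
  · refine Finset.sum_congr rfl fun y _ => ?_
    rw [← tensorPow_conjTranspose, ← tensorPow_mul, ← tensorPow_mul, tensorPow_apply]
    -- Since these diagonal entries are real, the real part of their product is the product of the
    -- real parts.
    have hreal : ∀ z, (Vᴴ * unitaryDiag U lam * V) z z = (r z : ℂ) := fun z => by
      refine Complex.ext rfl ?_
      rw [Complex.ofReal_im]
      exact (Complex.le_def.mp
        ((hρ.1.conjTranspose_mul_mul_same V).diag_nonneg (i := z))).2.symm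
    simp only [hreal]
    rw [← Complex.ofReal_prod, Complex.ofReal_re]

end Concentration

/-! ### Passing between the `limsup` of exponents and exponential bounds. -/

section ExponentialRate

theorem inv_mul_log_le_inv_mul_log (n : ℕ) {x y : ℝ} (h : x ≤ y) :
    (((1 : ℝ) / n : ℝ) : EReal) * ENNReal.log (ENNReal.ofReal x)
      ≤ (((1 : ℝ) / n : ℝ) : EReal) * ENNReal.log (ENNReal.ofReal y) := by
  have h0 : (0 : EReal) ≤ (((1 : ℝ) / n : ℝ) : EReal) := by
    exact_mod_cast (by positivity : (0 : ℝ) ≤ 1 / n)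
  gcongr

theorem inv_mul_log_exp {n : ℕ} (hn : 0 < n) (x : ℝ) :
    (((1 : ℝ) / n : ℝ) : EReal) * ENNReal.log (ENNReal.ofReal (Real.exp (n * x))) = x := by
  rw [ENNReal.log_ofReal_of_pos (Real.exp_pos _), Real.log_exp, ← EReal.coe_mul]
  congr 1
  field_simp

theorem limsup_inv_mul_log_le {y : ℕ → ℝ} {R : ℝ} (h : ∀ n, y n ≤ Real.exp (-(n * R))) :
    limsup (fun n : ℕ => (((1 : ℝ) / n : ℝ) : EReal) * ENNReal.log (ENNReal.ofReal (y n))) atTop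
      ≤ ((-R : ℝ) : EReal) := by
  refine limsup_le_of_le (h := ?_)
  filter_upwards [eventually_gt_atTop 0] with n hn
  rw [← inv_mul_log_exp hn (-R)]
  refine inv_mul_log_le_inv_mul_log n ((h n).trans (le_of_eq ?_))
  rw [mul_neg]

/-- A bound on the `limsup` yields an eventual bound only at a strictly smaller rate, hence the gap
between `R'` and `R`. -/
theorem eventually_le_exp_of_limsup_le {y : ℕ → ℝ} {R R' : ℝ} (hR : R' < R)
    (h : limsup (fun n : ℕ => (((1 : ℝ) / n : ℝ) : EReal) * ENNReal.log (ENNReal.ofReal (y n)))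
      atTop ≤ ((-R : ℝ) : EReal)) :
    ∀ᶠ n : ℕ in atTop, y n ≤ Real.exp (-(n * R')) := by
  have hlt : ((-R : ℝ) : EReal) < ((-R' : ℝ) : EReal) := by
    exact_mod_cast neg_lt_neg hR
  filter_upwards [eventually_lt_of_limsup_lt (h.trans_lt hlt), eventually_gt_atTop 0] with n h1 hn
  by_contra! hcon
  rw [← inv_mul_log_exp hn (-R')] at h1
  rw [← mul_neg] at hcon
  exact absurd (inv_mul_log_le_inv_mul_log n hcon.le) (not_le.mpr h1)

end ExponentialRate

/-! ### The error exponent and likelihood ratios. -/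

section SteinExponent

variable {ι : Type*} [Fintype ι] [DecidableEq ι] {ρ σ : Matrix ι ι ℂ}
  {Ω : ℕ → Type*} [∀ n, Fintype (Ω n)]

/-- Neyman–Pearson: on the event, `p = (1 - T) p + T p ≤ (1 - T) p + a T q`; elsewhere the right
side is nonnegative. -/
theorem probOf_likelihood_le {Ω d : Type*} [Fintype Ω] [Fintype d] [DecidableEq d]
    (M : POVM Ω d) {ρ σ : Matrix d d ℂ} (hρ : ρ.PosSemidef) (hσ : σ.PosSemidef) {T : Ω → ℝ}
    (hT : ∀ i, T i ∈ Set.Icc (0 : ℝ) 1) {a : ℝ} (ha : 0 ≤ a) :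
    M.probOf ρ {i | M.prob ρ i < a * M.prob σ i}
      ≤ M.expect ρ (fun i => 1 - T i) + a * M.expect σ T := by
  classical
  rw [POVM.probOf, POVM.expect, POVM.expect, Finset.mul_sum, ← Finset.sum_add_distrib,
    Finset.sum_filter]
  refine Finset.sum_le_sum fun i _ => ?_
  have h1 := mul_nonneg (sub_nonneg.mpr (hT i).2) (M.prob_nonneg hρ i)
  have h2 := mul_nonneg ha (mul_nonneg (hT i).1 (M.prob_nonneg hσ i))
  split_ifs with h
  · have h3 := mul_le_mul_of_nonneg_left (le_of_lt h) (hT i).1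
    linarith
  · linarith

/-- The likelihood ratio test accepts where `q ≤ exp (-n R) p`; summing this bound controls its
second error by `exp (-n R)`. -/
theorem le_steinExponent {M : ∀ n, POVM (Ω n) (Fin n → ι)} (hρ : IsDensity ρ)
    {R : ℝ} (h : Tendsto (fun n : ℕ => (M n).probOf (tensorPow ρ n)
      {i | (M n).prob (tensorPow ρ n) i < Real.exp (n * R) * (M n).prob (tensorPow σ n) i})
      atTop (𝓝 0)) : (R : EReal) ≤ steinExponent M ρ σ := by
  classical
  refine le_sSup ⟨R, ⟨fun n i => if (M n).prob (tensorPow ρ n) i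
    < Real.exp (n * R) * (M n).prob (tensorPow σ n) i then 0 else 1, fun n i => ?_, ?_, ?_⟩, rfl⟩
  · dsimp only
    split_ifs <;> simp
  · refine h.congr fun n => ?_
    rw [POVM.probOf, POVM.expect, Finset.sum_filter]
    refine Finset.sum_congr rfl fun i _ => ?_
    simp only [Set.mem_ofPred_eq]
    split_ifs <;> simp
  · refine limsup_inv_mul_log_le fun n => ?_
    have h1 : (M n).expect (tensorPow σ n) (fun i => if (M n).prob (tensorPow ρ n) i
        < Real.exp (n * R) * (M n).prob (tensorPow σ n) i then 0 else 1)
        ≤ ∑ i, Real.exp (-(n * R)) * (M n).prob (tensorPow ρ n) i := by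
      refine Finset.sum_le_sum fun i _ => ?_
      have h2 := mul_nonneg (Real.exp_pos (-(n * R))).le ((M n).prob_nonneg (hρ.tensorPow n).1 i)
      dsimp only
      split_ifs with hi
      · simpa using h2
      · rw [one_mul, Real.exp_neg, ← div_eq_inv_mul, le_div_iff₀ (Real.exp_pos _), mul_comm]
        exact not_lt.mp hi
    rwa [← Finset.mul_sum, (M n).sum_prob, (hρ.tensorPow n).2, Complex.one_re, mul_one] at h1

/-- The elements of an event sum to a projection, so the strong converse for projective tests
applies. -/
theorem tendsto_probOf_of_probOf_le_exp (hρ : IsDensity ρ) (hσ : IsDensity σ)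
    (hσ_inv : IsUnit σ) {M : ∀ n, PVM (Ω n) (Fin n → ι)} {ε : ℝ} (hε : 0 < ε)
    {S : ∀ n, Set (Ω n)}
    (hS : ∀ᶠ n : ℕ in atTop, (M n).probOf (tensorPow σ n) (S n)
      ≤ Real.exp (-(n * (quantumRelEntropy ρ σ + ε)))) :
    Tendsto (fun n : ℕ => (M n).probOf (tensorPow ρ n) (S n)) atTop (𝓝 0) := by
  simp only [POVM.probOf, POVM.sum_prob_finset] at hS ⊢
  exact tendsto_trace_of_trace_le_exp hρ hσ hσ_inv (fun n => (M n).isStarProjection_sum _) hε hS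

/-- No measurement beats the quantum relative entropy. -/
theorem steinExponent_le (hρ : IsDensity ρ) (hσ : IsDensity σ)
    (hσ_inv : IsUnit σ) (M : ∀ n, PVM (Ω n) (Fin n → ι)) :
    steinExponent (fun n => (M n).toPOVM) ρ σ ≤ (quantumRelEntropy ρ σ : EReal) := by
  refine sSup_le ?_
  rintro _ ⟨R, ⟨T, hT, hT1, hT2⟩, rfl⟩
  by_contra! hcon
  have hR : quantumRelEntropy ρ σ < R := by exact_mod_cast hcon
  set D := quantumRelEntropy ρ σ with hD
  obtain ⟨ε, hε, hεR⟩ : ∃ ε, 0 < ε ∧ D + 2 * ε < R :=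
    ⟨(R - D) / 4, by linarith, by linarith⟩
  -- Rounding `T` at `1/2` produces an event, at the cost of a factor two in each error by Markov's
  -- inequality; `exp (-n ε) < 1/2` absorbs this factor for `σ`.
  set S : ∀ n, Set (Ω n) := fun n => {i | 1 / 2 ≤ T n i} with hS
  have hSσ : ∀ᶠ n : ℕ in atTop, (M n).probOf (tensorPow σ n) (S n)
      ≤ Real.exp (-(n * (D + ε))) := by
    filter_upwards [eventually_le_exp_of_limsup_le hεR hT2,
      (tendsto_exp_neg_mul hε).eventually_lt_const (show (0 : ℝ) < 1 / 2 by norm_num)]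
      with n h1 h2
    have h3 := (M n).mul_probOf_le_expect (hσ.tensorPow n).1 (fun i => (hT n i).1) (1 / 2)
    have h4 : Real.exp (-(n * (D + 2 * ε)))
        = Real.exp (-(n * (D + ε))) * Real.exp (-(n * ε)) := by
      rw [← Real.exp_add]
      congr 1
      ring
    have h5 := mul_le_mul_of_nonneg_left h2.le (Real.exp_pos (-(n * (D + ε)))).le
    have h6 : 1 / 2 * (M n).probOf (tensorPow σ n) (S n) ≤ _ := h3
    linarith
  have hlim1 := tendsto_probOf_of_probOf_le_exp hρ hσ hσ_inv (M := M) hε hSσ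
  have hlim2 : Tendsto (fun n : ℕ => (M n).probOf (tensorPow ρ n) (S n)
      + 2 * (M n).expect (tensorPow ρ n) (fun i => 1 - T n i)) atTop (𝓝 0) := by
    simpa using hlim1.add (hT1.const_mul 2)
  obtain ⟨n, hn⟩ := (hlim2.eventually_lt_const one_pos).exists
  have h1 := (M n).probOf_add_compl (tensorPow ρ n) (S n)
  rw [(hρ.tensorPow n).2, Complex.one_re] at h1
  have h2 := (M n).mul_probOf_le_expect (hρ.tensorPow n).1
    (fun i => sub_nonneg.mpr (hT n i).2) (1 / 2)
  have h3 : (M n).probOf (tensorPow ρ n) (S n)ᶜ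
      ≤ (M n).probOf (tensorPow ρ n) {i | 1 / 2 ≤ 1 - T n i} := by
    refine (M n).probOf_mono (hρ.tensorPow n).1 fun i _ hi => ?_
    simp only [hS, Set.mem_compl_iff, Set.mem_ofPred_eq, not_le] at hi ⊢
    linarith
  linarith

theorem tendsto_probOf_likelihood_of_lt_steinExponent {M : ∀ n, POVM (Ω n) (Fin n → ι)}
    (hρ : IsDensity ρ) (hσ : IsDensity σ) {R : ℝ} (h : (R : EReal) < steinExponent M ρ σ) :
    Tendsto (fun n : ℕ => (M n).probOf (tensorPow ρ n)
      {i | (M n).prob (tensorPow ρ n) i < Real.exp (n * R) * (M n).prob (tensorPow σ n) i})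
      atTop (𝓝 0) := by
  obtain ⟨_, ⟨R', ⟨T, hT, hT1, hT2⟩, rfl⟩, hR⟩ := lt_sSup_iff.mp h
  have hR' : R < R' := EReal.coe_lt_coe_iff.mp hR
  -- The midpoint leaves half of the gap for the `limsup` bound and half for the decay of `exp (n
  -- R)` times the second error.
  have hmid : (R + R') / 2 < R' := by linarith
  have hgap : 0 < (R' - R) / 2 := by linarith
  have hlim : Tendsto (fun n : ℕ => (M n).expect (tensorPow ρ n) (fun i => 1 - T n i)
      + Real.exp (-(n * ((R' - R) / 2)))) atTop (𝓝 0) := by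
    simpa using hT1.add (tendsto_exp_neg_mul hgap)
  refine squeeze_zero' (Eventually.of_forall fun n => (M n).probOf_nonneg (hρ.tensorPow n).1 _)
    ?_ hlim
  filter_upwards [eventually_le_exp_of_limsup_le hmid hT2] with n hn
  refine (probOf_likelihood_le (M n) (hρ.tensorPow n).1 (hσ.tensorPow n).1 (hT n)
    (Real.exp_pos _).le).trans (add_le_add le_rfl ?_)
  refine (mul_le_mul_of_nonneg_left hn (Real.exp_pos _).le).trans (le_of_eq ?_)
  rw [← Real.exp_add]
  congr 1
  ring

theorem steinExponent_eq_iff (hρ : IsDensity ρ) (hσ : IsDensity σ)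
    (hσ_inv : IsUnit σ) (M : ∀ n, PVM (Ω n) (Fin n → ι)) :
    steinExponent (fun n => (M n).toPOVM) ρ σ = (quantumRelEntropy ρ σ : EReal) ↔
      ∀ ε : ℝ, 0 < ε → Tendsto (fun n : ℕ => (M n).probOf (tensorPow ρ n)
        {i | (M n).prob (tensorPow ρ n) i < Real.exp (n * (quantumRelEntropy ρ σ - ε))
          * (M n).prob (tensorPow σ n) i}) atTop (𝓝 0) := by
  constructor
  · intro h ε hε
    refine tendsto_probOf_likelihood_of_lt_steinExponent (M := fun n => (M n).toPOVM) hρ hσ ?_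
    rw [h]
    exact_mod_cast sub_lt_self _ hε
  · intro h
    refine le_antisymm (steinExponent_le hρ hσ hσ_inv M) (le_of_forall_lt fun c hc => ?_)
    obtain ⟨r, hcr, hrD⟩ := EReal.lt_iff_exists_real_btwn.mp hc
    have hr : r < quantumRelEntropy ρ σ := by exact_mod_cast hrD
    have h1 := le_steinExponent (M := fun n => (M n).toPOVM) hρ (h _ (sub_pos.mpr hr))
    rw [sub_sub_cancel] at h1
    exact hcr.trans_le h1

theorem quantumRelEntropy_eq_sub {d : Type*} [Fintype d] [DecidableEq d] (ρ σ : Matrix d d ℂ) :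
    quantumRelEntropy ρ σ
      = (ρ * cfc Real.log ρ).trace.re - (ρ * cfc Real.log σ).trace.re := by
  rw [quantumRelEntropy, Matrix.mul_sub, Matrix.trace_sub, Complex.sub_re]

variable {I : ℕ → Type*} [∀ n, Fintype (I n)] {E : ∀ n, PVM (I n) (Fin n → ι)}
  {M : ∀ n, PVM (Ω n) (Fin n → ι)} {m : ℕ}

theorem steinExponent_eq_of_logProbConverges (hρ : IsDensity ρ) (hσ : IsDensity σ)
    (hσ_inv : IsUnit σ) (hEρ : ∀ n, (E n).CommutesWith (tensorPow ρ n))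
    (hEw : ∀ n, (E n).w ≤ (n + 1) ^ m) (hEM : ∀ n, (E n).RefinedBy (M n))
    (h : LogProbConverges (fun n => (M n).toPOVM) ρ σ (-(ρ * cfc Real.log σ).trace.re)) :
    steinExponent (fun n => (M n).toPOVM) ρ σ = (quantumRelEntropy ρ σ : EReal) := by
  rw [steinExponent_eq_iff hρ hσ hσ_inv, quantumRelEntropy_eq_sub]
  intro ε hε
  have hsmall := tendsto_probOf_prob_le hρ hEρ hEw hEM (half_pos hε)
  have hlog := h (ε / 4) (by linarith)
  set e := (ρ * cfc Real.log ρ).trace.re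
  set s := (ρ * cfc Real.log σ).trace.re
  have hlim := hsmall.add hlog
  rw [add_zero] at hlim
  refine squeeze_zero' (Eventually.of_forall fun n => (M n).probOf_nonneg (hρ.tensorPow n).1 _)
    ?_ hlim
  filter_upwards [eventually_gt_atTop 0] with n hn
  have hn' : (0 : ℝ) < n := by exact_mod_cast hn
  refine le_trans ((M n).probOf_mono (hρ.tensorPow n).1 fun i _ hi => ?_)
    ((M n).probOf_union_le (hρ.tensorPow n).1 _ _)
  simp only [Set.mem_union, Set.mem_ofPred_eq] at hi ⊢
  by_contra! hcon
  obtain ⟨h1, h2⟩ := hcon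
  set p := (M n).prob (tensorPow ρ n) i
  set q := (M n).prob (tensorPow σ n) i
  have hp : 0 < p := (Real.exp_pos _).trans h1
  -- Outcomes with `q = 0`, where `Real.log` returns `0` instead of `-∞`, never lie in the
  -- likelihood event.
  have hq : 0 < q := pos_of_mul_pos_right (hp.trans hi) (Real.exp_pos _).le
  have h3 := (abs_le.mp h2).1
  have h4 : Real.log q ≤ n * (s + ε / 4) := by
    have : Real.log q = n * (1 / n * Real.log q) := by field_simp
    rw [this]
    refine mul_le_mul_of_nonneg_left ?_ hn'.le
    linarith
  have h5 : q ≤ Real.exp (n * (s + ε / 4)) := (Real.log_le_iff_le_exp hq).mp h4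
  have h6 : Real.exp (n * (e - s - ε)) * q ≤ Real.exp (n * (e - ε / 2)) := by
    refine (mul_le_mul_of_nonneg_left h5 (Real.exp_pos _).le).trans ?_
    rw [← Real.exp_add, Real.exp_le_exp, ← mul_add]
    refine mul_le_mul_of_nonneg_left ?_ hn'.le
    linarith
  linarith

theorem logProbConverges_of_steinExponent_eq (hρ : IsDensity ρ) (hσ : IsDensity σ)
    (hσ_inv : IsUnit σ) (hEρ : ∀ n, (E n).CommutesWith (tensorPow ρ n))
    (hEw : ∀ n, (E n).w ≤ (n + 1) ^ m) (hEM : ∀ n, (E n).RefinedBy (M n))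
    (hM : ∀ n i, ((M n).elem i).trace.re ≤ 1)
    (h : steinExponent (fun n => (M n).toPOVM) ρ σ = (quantumRelEntropy ρ σ : EReal)) :
    LogProbConverges (fun n => (M n).toPOVM) ρ σ (-(ρ * cfc Real.log σ).trace.re) := by
  intro ε hε
  have hsmall := tendsto_probOf_prob_le hρ hEρ hEw hEM (half_pos hε)
  have hlarge := tendsto_probOf_le_prob (M := fun n => (M n).toPOVM) hρ hM (half_pos hε)
  have hlow := (steinExponent_eq_iff hρ hσ hσ_inv M).mp h _ (half_pos hε)
  -- Where `q ≤ exp (-a) p`, summation gives `σ`-probability at most `exp (-a)`; the strong converse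
  -- then makes the event rare under `ρ`.
  have hhigh := tendsto_probOf_of_probOf_le_exp hρ hσ hσ_inv (M := M) (half_pos hε)
    (S := fun n => {i | Real.exp (n * (quantumRelEntropy ρ σ + ε / 2))
      * (M n).prob (tensorPow σ n) i ≤ (M n).prob (tensorPow ρ n) i})
    (Eventually.of_forall fun n => by
      classical
      set a := (n : ℝ) * (quantumRelEntropy ρ σ + ε / 2)
      calc _ ≤ ∑ i, Real.exp (-a) * (M n).prob (tensorPow ρ n) i := by
            rw [POVM.probOf]
            refine le_trans (Finset.sum_le_sum fun i hi => ?_)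
              (Finset.sum_le_sum_of_subset_of_nonneg (Finset.filter_subset _ _) fun i _ _ =>
                mul_nonneg (Real.exp_pos _).le ((M n).prob_nonneg (hρ.tensorPow n).1 i))
            rw [Real.exp_neg, ← div_eq_inv_mul, le_div_iff₀ (Real.exp_pos _), mul_comm]
            exact (Finset.mem_filter.mp hi).2
        _ = _ := by
            rw [← Finset.mul_sum, POVM.sum_prob, (hρ.tensorPow n).2, Complex.one_re, mul_one])
  rw [quantumRelEntropy_eq_sub] at hlow hhigh
  set e := (ρ * cfc Real.log ρ).trace.re
  set s := (ρ * cfc Real.log σ).trace.re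
  have hlim := (hsmall.add hlarge).add (hlow.add hhigh)
  simp only [add_zero] at hlim
  refine squeeze_zero' (Eventually.of_forall fun n => (M n).probOf_nonneg (hρ.tensorPow n).1 _)
    ?_ hlim
  filter_upwards [eventually_gt_atTop 0] with n hn
  have hn' : (0 : ℝ) < n := by exact_mod_cast hn
  have hpos := (hρ.tensorPow n).1
  refine le_trans ((M n).probOf_mono hpos fun i _ hi => ?_)
    (((M n).probOf_union_le hpos _ _).trans
      (add_le_add ((M n).probOf_union_le hpos _ _) ((M n).probOf_union_le hpos _ _)))
  simp only [Set.mem_union, Set.mem_ofPred_eq] at hi ⊢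
  by_contra! hcon
  obtain ⟨⟨h1, h2⟩, h3, h4⟩ := hcon
  set p := (M n).prob (tensorPow ρ n) i
  set q := (M n).prob (tensorPow σ n) i
  have hp : 0 < p := (Real.exp_pos _).trans h1
  -- Outcomes with `q = 0` belong to the fourth exceptional event.
  have hq : 0 < q := pos_of_mul_pos_right (hp.trans h4) (Real.exp_pos _).le
  have l1 := (Real.lt_log_iff_exp_lt hp).mpr h1
  have l2 := (Real.log_lt_iff_lt_exp hp).mpr h2
  have l3 := Real.log_le_log (by positivity) h3
  have l4 := Real.log_lt_log hp h4
  rw [Real.log_mul (Real.exp_pos _).ne' hq.ne', Real.log_exp] at l3 l4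
  have hlogq : Real.log q = n * (1 / n * Real.log q) := by field_simp
  set y := 1 / (n : ℝ) * Real.log q with hy
  have u1 : y < s + ε := by
    refine lt_of_mul_lt_mul_left ?_ hn'.le
    rw [← hlogq]
    linarith
  have u2 : s - ε < y := by
    refine lt_of_mul_lt_mul_left ?_ hn'.le
    rw [← hlogq]
    linarith
  refine absurd hi (not_lt.mpr (abs_le.mpr ?_))
  rw [neg_mul, ← hy]
  constructor <;> linarith

/-- Here `q = ν Tr M_i` with `Tr M_i ≤ (n + 1) ^ m`, so a bound on the eigenvalue bounds `q`. Rank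
one is not needed, which lets the same statement serve the product measurement. -/
theorem steinExponent_eq_of_eigenvalues (hρ : IsDensity ρ) (hσ : IsDensity σ)
    (hσ_inv : IsUnit σ) (hEρ : ∀ n, (E n).CommutesWith (tensorPow ρ n))
    (hEw : ∀ n, (E n).w ≤ (n + 1) ^ m) (hEM : ∀ n, (E n).RefinedBy (M n))
    {ν : ∀ n, Ω n → ℝ}
    (hν : ∀ n i, tensorPow σ n * (M n).elem i = (ν n i : ℂ) • (M n).elem i) :
    steinExponent (fun n => (M n).toPOVM) ρ σ = (quantumRelEntropy ρ σ : EReal) := by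
  rw [steinExponent_eq_iff hρ hσ hσ_inv, quantumRelEntropy_eq_sub]
  intro ε hε
  have hε3 : 0 < ε / 3 := by linarith
  have hsmall := tendsto_probOf_prob_le hρ hEρ hEw hEM hε3
  have heig := tendsto_probOf_eigenvalue_gt hρ hσ hσ_inv hν hε3
  set e := (ρ * cfc Real.log ρ).trace.re
  set s := (ρ * cfc Real.log σ).trace.re
  have hlim := hsmall.add heig
  rw [add_zero] at hlim
  refine squeeze_zero' (Eventually.of_forall fun n => (M n).probOf_nonneg (hρ.tensorPow n).1 _)
    ?_ hlim
  filter_upwards [(tendsto_polynomial_mul_exp_neg m hε3).eventually_lt_const one_pos] with n hn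
  refine le_trans ((M n).probOf_mono (hρ.tensorPow n).1 fun i _ hi => ?_)
    ((M n).probOf_union_le (hρ.tensorPow n).1 _ _)
  simp only [Set.mem_union, Set.mem_ofPred_eq] at hi ⊢
  by_contra! hcon
  obtain ⟨h1, h2⟩ := hcon
  have hq : (M n).prob (tensorPow σ n) i = ν n i * ((M n).elem i).trace.re := by
    rw [POVM.prob, Matrix.trace_mul_comm, hν, Matrix.trace_smul, smul_eq_mul, Complex.re_ofReal_mul]
  have htr : ((M n).elem i).trace.re ≤ ((n : ℝ) + 1) ^ m :=
    (PVM.trace_re_le_of_refinedBy (hEM n) i).trans (by exact_mod_cast hEw n)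
  have h3 : (M n).prob (tensorPow σ n) i
      ≤ Real.exp (n * (s + ε / 3)) * ((n : ℝ) + 1) ^ m := by
    rw [hq]
    exact mul_le_mul h2 htr ((M n).posSemidef i).trace_re_nonneg (Real.exp_pos _).le
  have h4 : Real.exp (n * (e - s - ε)) * (M n).prob (tensorPow σ n) i
      ≤ Real.exp (n * (e - ε / 3)) := by
    calc _ ≤ Real.exp (n * (e - s - ε)) * (Real.exp (n * (s + ε / 3)) * ((n : ℝ) + 1) ^ m) :=
          mul_le_mul_of_nonneg_left h3 (Real.exp_pos _).le
      -- Of the slack `ε`, one third goes to `p`, one third to the eigenvalue, and the last beats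
      -- the polynomial.
      _ = Real.exp (n * (e - ε / 3)) * (((n : ℝ) + 1) ^ m * Real.exp (-(n * (ε / 3)))) := by
          rw [← mul_assoc, ← Real.exp_add, mul_left_comm, ← Real.exp_add, mul_comm]
          congr 2
          ring
      _ ≤ _ := mul_le_of_le_one_right (Real.exp_pos _).le hn.le
  linarith

end SteinExponent

/-! ### Product with the spectral measurement. -/

section ProductMeasurement

variable {Ω Ω' d : Type*} [Fintype Ω] [Fintype Ω'] [Fintype d] [DecidableEq d]

theorem PVM.refinedBy_prod (E : PVM Ω d) (F : PVM Ω' d) (h : ∀ j, E.CommutesWith (F.elem j)) :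
    E.RefinedBy (E.prod F h) := by
  classical
  intro i
  refine ⟨Finset.univ.image fun j => (i, j), ?_⟩
  rw [Finset.sum_image fun j _ k _ hjk => (Prod.ext_iff.mp hjk).2]
  change E.elem i = ∑ j, E.elem i * F.elem j
  rw [← Finset.mul_sum, F.sum_eq_one, mul_one]

theorem mul_eigenProj {A : Matrix d d ℂ} (hA : A.IsHermitian) (x : ℝ) :
    A * eigenProj A x = (x : ℂ) • eigenProj A x := by
  classical
  have hA' : IsSelfAdjoint A := hA
  have hc : ∀ f : ℝ → ℝ, ContinuousOn f (spectrum ℝ A) := fun f =>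
    A.finite_real_spectrum.continuousOn f
  have h : A * eigenProj A x = x • eigenProj A x := by
    simp only [eigenProj]
    rw [← cfc_const_mul _ _ A (hc _)]
    conv_lhs => enter [1]; rw [← cfc_id' ℝ A]
    rw [← cfc_mul _ _ A (hc _) (hc _)]
    congr 1
    funext t
    split_ifs with ht <;> simp [ht]
  rw [h]
  ext i j
  simp

end ProductMeasurement

end

theorem theorem2 {ι : Type*} [Fintype ι] [DecidableEq ι] (ρ σ : Matrix ι ι ℂ)
    (hρ : IsDensity ρ) (hσ : IsDensity σ) (hσ_inv : IsUnit σ)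
    {I : ℕ → Type*} [∀ n, Fintype (I n)] (E : ∀ n, PVM (I n) (Fin n → ι))
    (hEρ : ∀ n, (E n).CommutesWith (tensorPow ρ n))
    (hEσ : ∀ n, (E n).CommutesWith (tensorPow σ n))
    (m : ℕ) (hEw : ∀ n, (E n).w ≤ (n + 1) ^ m) :
    -- the characterization of optimality for rank-one refinements of `E`
    (∀ (Ω : ℕ → Type*) [∀ n, Fintype (Ω n)] (M : ∀ n, PVM (Ω n) (Fin n → ι)),
      (∀ n, (E n).RefinedBy (M n)) → (∀ n, (M n).w = 1) →
      (steinExponent (fun n => (M n).toPOVM) ρ σ = (quantumRelEntropy ρ σ : EReal) ↔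
        LogProbConverges (fun n => (M n).toPOVM) ρ σ (-(ρ * cfc Real.log σ).trace.re))) ∧
    -- rank-one refinements of `E` that commute with `σ^{⊗ n}` are optimal
    (∀ (Ω : ℕ → Type*) [∀ n, Fintype (Ω n)] (M : ∀ n, PVM (Ω n) (Fin n → ι)),
      (∀ n, (E n).RefinedBy (M n)) → (∀ n, (M n).w = 1) →
      (∀ n, (M n).CommutesWith (tensorPow σ n)) →
      steinExponent (fun n => (M n).toPOVM) ρ σ = (quantumRelEntropy ρ σ : EReal)) ∧
    -- `E^n × E(σ^{⊗ n})` is an optimal sequence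
    steinExponent (fun n => ((E n).prod
        (spectralPVM (tensorPow σ n) (hσ.tensorPow_isHermitian n))
        ((hEσ n).spectral (hσ.tensorPow_isHermitian n))).toPOVM) ρ σ
      = (quantumRelEntropy ρ σ : EReal) := by

  refine ⟨fun Ω _ M hEM hw => ⟨?_, ?_⟩, fun Ω _ M hEM hw hM => ?_, ?_⟩
  · refine logProbConverges_of_steinExponent_eq hρ hσ hσ_inv hEρ hEw hEM fun n i => ?_
    rw [((M n).isStarProjection i).isIdempotentElem.matrix_trace_re_eq_rank]
    exact_mod_cast (hw n) ▸ (M n).rank_elem_le_w i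
  · exact steinExponent_eq_of_logProbConverges hρ hσ hσ_inv hEρ hEw hEM
  -- A rank-one projection commuting with `σ^{⊗ n}` projects onto an eigenvector; `ν` collects the
  -- eigenvalues.
  · choose ν hν using fun n i =>
      ((M n).isStarProjection i).exists_mul_eq_smul_of_rank_le_one
        ((hw n) ▸ (M n).rank_elem_le_w i) (hσ.tensorPow_isHermitian n) (hM n i)
    exact steinExponent_eq_of_eigenvalues hρ hσ hσ_inv hEρ hEw hEM hν
  · refine steinExponent_eq_of_eigenvalues (ν := fun n p => (p.2 : ℝ)) hρ hσ hσ_inv hEρ hEw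
      (fun n => (E n).refinedBy_prod _ _) fun n p => ?_
    change tensorPow σ n * ((E n).elem p.1 * eigenProj (tensorPow σ n) p.2)
      = ((p.2 : ℝ) : ℂ) • ((E n).elem p.1 * eigenProj (tensorPow σ n) p.2)
    rw [← Matrix.mul_assoc, hEσ n p.1, Matrix.mul_assoc,
      mul_eigenProj (hσ.tensorPow_isHermitian n), Matrix.mul_smul]
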